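/- Let $p$ be a prime, $s,m,\ell\ge 1$ integers, $q=p^s$, and $e=\frac{q^m-1}{q-1}$. Let $\mathbb F_q\subseteq\mathbb F_{q^m}$, let $\mathbb F_{q^{m\ell}}$ and $\mathbb F_{q^{m(\ell+1)}}$ be extensions of $\mathbb F_{q^m}$ of degrees $\ell$ and $\ell+1$, and write $N$ for the norm from either of them to $\mathbb F_{q^m}$. For $0\le r\le m$ put $$v=q^{m(2\ell+1)},\qquad k_r=\frac{(q^r-1)(q^{m\ell}-1)(q^{m(\ell+1)}-1)}{q^m-1}+q^{m\ell}-1,$$ $$\lambda_r=\frac{(q^r-1)(q^{m(\ell+1)}-1)}{q^m-1}\Big(\frac{(q^r-1)(q^{m\ell}-1)}{q^m-1}-1\Big)+q^{m\ell}-2,$$ $$\mu_r=\frac{(q^r-1)(q^{m\ell}-1)}{q^m-1}\Big(\frac{(q^r-1)(q^{m(\ell+1)}-1)}{q^m-1}+1\Big);$$ these are nonnegative integers. Definitions. A $(v,k,\lambda,\mu)$-PDS (partial difference set) in an additively written group $G$ of order $v$ is a $k$-subset $D\subseteq G\setminus\{0\}$ such that every element of $D$ is a difference $g-h$ of distinct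 $g,h\in D$ in exactly $\lambda$ ways and every nonzero element of $G\setminus D$ in exactly $\mu$ ways. If $0\notin D=-D$, then $\mathrm{Cay}(G,D)$ is the graph on $G$ in which $g,h$ are adjacent iff $g-h\in D$. A $(v,k,\lambda,\mu)$-SRG is a $k$-regular simple graph on $v$ vertices, neither complete nor edgeless, in which any two adjacent vertices have $\lambda$ and any two distinct non-adjacent vertices have $\mu$ common neighbours. For a primitive element $\omega$ of a finite field (a generator of its multiplicative group), the cyclotomic classes of order $e$ are the cosets $\omega^i\langle\omega^e\rangle$ of $\langle \omega^e\rangle$, with $i$ read modulo $e$. Let $\gamma$ be a primitive element of $\mathbb F_{q^m}$. There are primitive elements $\alpha$ of $\mathbb F_{q^{m\ell}}$ and $\beta$ of $\mathbb F_{q^{m(\ell+1)}}$ with $N(\alpha)=N(\beta)=\gamma$. For any such choice write $C_i^{(e,q^m)}=\gamma^i\langle\gamma^e\rangle$, $C_i^{(e,q^{m\ell})}=\alpha^i\langle\alpha^e\rangle$ and $C_i^{(e,q^{m(\ell+1)})}=\beta^i\langle\beta^e\rangle$. Theorem. Let $R$ be an $r$-dimensional $\mathbb F_q$-subspace of $\mathbb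 F_{q^m}$ ($0\le r\le m$), $R^*=R\setminus\{0\}$, and $T=\{0\le i<e:\gamma^i\in R\}$. Then $$D_{r,T}=\bigcup_{i=0}^{e-1}\Big(C_i^{(e,q^{m\ell})}\times\bigcup_{t\in T}C_{i+t}^{(e,q^{m(\ell+1)})}\Big)\cup\big(\mathbb F_{q^{m\ell}}^*\times\{0\}\big)$$ is a $(v,k_r,\lambda_r,\mu_r)$-PDS in the elementary abelian $p$-group $G=(\mathbb F_{q^{m\ell}}\times\mathbb F_{q^{m(\ell+1)}},+)\cong\mathbb Z_p^{sm(2\ell+1)}$. Moreover $$D_{r,T}=\Big\{(a,b):ab\ne0,\ \tfrac{N(b)}{N(a)}\in\bigcup_{t\in T}C_t^{(e,q^m)}\Big\}\cup\{(a,0):a\ne0\}=\Big\{(a,b):ab\ne0,\ \tfrac{N(b)}{N(a)}\in R^*\Big\}\cup\{(a,0):a\ne0\},$$ where $ab\neq 0$ means $a\ne0$ and $b\ne0$. Consequently $D_{r,T}=-D_{r,T}$, $\mathrm{Cay}(G,D_{r,T})$ is a $(v,k_r,\lambda_r,\mu_r)$-SRG, and $\mathbb F_{q^{m\ell}}\times\{0\}$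 is a maximum clique in it, of size $q^{m\ell}$. In particular, for every $0\le r\le m$ there is a $(v,k_r,\lambda_r,\mu_r)$-PDS $D_r$ in $\mathbb Z_p^{sm(2\ell+1)}$ for which $\mathrm{Cay}(\mathbb Z_p^{sm(2\ell+1)},D_r)$ is a $(v,k_r,\lambda_r,\mu_r)$-SRG. -/

import Mathlib

universe u₁ u₂ u₃ u₄

/-- `D` is a `(v, k, lam, mu)` partial difference set in the finite additive group `G`. -/
structure IsPDS {G : Type*} [AddGroup G] [Finite G] (D : Set G) (v k lam mu : ℕ) : Prop where
  card_group : Nat.card G = v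
  card_set : D.ncard = k
  zero_notMem : (0 : G) ∉ D
  of_mem : ∀ x ∈ D,
    {z : G × G | z.1 ∈ D ∧ z.2 ∈ D ∧ z.1 ≠ z.2 ∧ z.1 - z.2 = x}.ncard = lam
  of_notMem : ∀ x : G, x ≠ 0 → x ∉ D →
    {z : G × G | z.1 ∈ D ∧ z.2 ∈ D ∧ z.1 ≠ z.2 ∧ z.1 - z.2 = x}.ncard = mu

/-- `Γ` is a `(v, k, lam, mu)` strongly regular graph, neither complete nor edgeless. -/
structure IsSRG {V : Type*} [Fintype V] (Γ : SimpleGraph V) (v k lam mu : ℕ) : Prop where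
  srg : open Classical in Γ.IsSRGWith v k lam mu
  ne_top : Γ ≠ ⊤
  ne_bot : Γ ≠ ⊥

/-- `D` is a legitimate connection set (`0 ∉ D` and `D = -D`), and the Cayley graph `Cay(G, D)`
is a `(v, k, lam, mu)` strongly regular graph. For such `D`, two vertices `g`, `h` of
`SimpleGraph.addCayley D` are adjacent if and only if `g - h ∈ D`. -/
structure IsCayleySRG {G : Type*} [AddGroup G] [Fintype G] (D : Set G) (v k lam mu : ℕ) :
    Prop where
  zero_notMem : (0 : G) ∉ D
  neg_mem_iff : ∀ g : G, -g ∈ D ↔ g ∈ D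
  isSRG : IsSRG (SimpleGraph.addCayley D) v k lam mu

/-- The generalized Denniston parameters. The equations are between rational numbers, so neither
subtraction nor division is truncated. -/
structure IsGenDennistonParams (q m l r : ℕ) (v k lam mu : ℕ) : Prop where
  v_eq : v = q ^ (m * (2 * l + 1))
  k_eq : (k : ℚ) = ((q : ℚ) ^ r - 1) * ((q : ℚ) ^ (m * l) - 1) * ((q : ℚ) ^ (m * (l + 1)) - 1)
      / ((q : ℚ) ^ m - 1) + (q : ℚ) ^ (m * l) - 1
  lam_eq : (lam : ℚ) = ((q : ℚ) ^ r - 1) * ((q : ℚ) ^ (m * (l + 1)) - 1) / ((q : ℚ) ^ m - 1)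
      * (((q : ℚ) ^ r - 1) * ((q : ℚ) ^ (m * l) - 1) / ((q : ℚ) ^ m - 1) - 1)
      + (q : ℚ) ^ (m * l) - 2
  mu_eq : (mu : ℚ) = ((q : ℚ) ^ r - 1) * ((q : ℚ) ^ (m * l) - 1) / ((q : ℚ) ^ m - 1)
      * (((q : ℚ) ^ r - 1) * ((q : ℚ) ^ (m * (l + 1)) - 1) / ((q : ℚ) ^ m - 1) + 1)

/-- A primitive element of a finite field: a generator of the multiplicative group. -/
def IsPrimitiveElt {F : Type*} [Field F] (ω : Fˣ) : Prop :=
  ∀ x : Fˣ, x ∈ Subgroup.zpowers ω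

/-- The coset `ω ^ i ⟨ω ^ e⟩`, as a subset of the field: the `i`-th cyclotomic class of order `e`
with respect to `ω` (the index only matters modulo `e`). -/
def cyclotomicClass {F : Type*} [Field F] (ω : Fˣ) (e i : ℕ) : Set F :=
  {x | ∃ u ∈ Subgroup.zpowers (ω ^ e), x = ((ω ^ i * u : Fˣ) : F)}

/-- `T = {0 ≤ i < e | γ ^ i ∈ R}`. -/
def exponentSet {F E : Type*} [Field F] [Field E] [Algebra F E] (R : Submodule F E) (γ : Eˣ)
    (e : ℕ) : Set ℕ :=
  {i | i < e ∧ (γ : E) ^ i ∈ R}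

/-- The union of the products `C_i × C_{i+t}`, for `0 ≤ i < e` and `t ∈ T`, of cyclotomic classes
of order `e` (with respect to `α` and `β`), together with `K^* × {0}`. -/
def dennistonSet {K L : Type*} [Field K] [Field L] (α : Kˣ) (β : Lˣ) (e : ℕ) (T : Set ℕ) :
    Set (K × L) :=
  (⋃ i ∈ Finset.range e, cyclotomicClass α e i ×ˢ ⋃ t ∈ T, cyclotomicClass β e (i + t)) ∪
    ({0}ᶜ ×ˢ {0})

/-! ### Newton's identities for sums over monic polynomials -/

section MonicPolynomials

open Polynomial UniqueFactorizationMonoid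

variable (E : Type*) [Field E] [Finite E]

/-! Let E, K, L be the fields of orders q^m, q^(ml), q^(m(l+1)). Taking logarithms to the bases α,
β, γ turns the cyclotomic union into `normSet`, the pairs with a ≠ 0 and N(b)/N(a) ∈ R; the pairs
with b = 0 enter because 0 ∈ R (`dennistonSet_eq_normSet`). A symmetric set is a partial difference
set once its character sums satisfy the quadratic equation attached to k, λ, μ
(`isPDS_of_sum_addChar`), so everything rests on the sums S(c, d) of ψ(Tr(ca) + Tr(db)) over
`normSet`.

Put A = |K|, x = |R| - 1, e = (A - 1)/(|E| - 1) and e' = (|L| - 1)/(|E| - 1) = e + A; this e is a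
norm fibre size, not the order of the cyclotomic classes. If c or d is 0, counting norm fibres gives
S(c, d). If neither is, the consecutive degrees matter: by Hasse–Davenport, a sum of h(N(b))
ψ(Tr(b)) over L is minus the sum of h(u N(t)) ψ(u + Tr(t)) over u ∈ E, t ∈ K
(`sum_norm_trace_succ`). Orthogonality in a then isolates t = -c and leaves ψ summed over an
additive subgroup, which is 0 or |R|. The nontrivial sums therefore take only the values A - 1 - xe
and -(1 + xe'), the two roots of the quadratic (`isPDS_normSet`).

Hasse–Davenport comes from an L-function: the Euler product of `gaussCoeff` over monic irreducibles
is a polynomial of degree at most 1, since its coefficients in degree 2 and above vanish, and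
Newton's identities then make consecutive power sums proportional. -/

theorem finite_monic_natDegree_eq (n : ℕ) : {f : E[X] | f.Monic ∧ f.natDegree = n}.Finite := by
  refine Set.Finite.of_finite_image (f := fun f (i : Fin (n + 1)) ↦ f.coeff i)
    (Set.toFinite _) ?_
  rintro f ⟨-, hf⟩ g ⟨-, hg⟩ h
  ext i
  rcases lt_or_ge i (n + 1) with hi | hi
  · exact congrFun h ⟨i, hi⟩
  · rw [coeff_eq_zero_of_natDegree_lt (by omega), coeff_eq_zero_of_natDegree_lt (by omega)]

/-- The monic polynomials of degree `n` over a finite field. -/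
noncomputable def monicsOfDegree (n : ℕ) : Finset E[X] :=
  (finite_monic_natDegree_eq E n).toFinset

open Classical in
/-- The monic irreducible polynomials over a finite field whose degree divides `n`, for `n ≠ 0`. -/
noncomputable def monicIrreducibles (n : ℕ) : Finset E[X] :=
  ((Finset.range (n + 1)).biUnion (monicsOfDegree E)).filter
    fun P ↦ Irreducible P ∧ P.natDegree ∣ n

variable {E}

@[simp]
theorem mem_monicsOfDegree {n : ℕ} {f : E[X]} :
    f ∈ monicsOfDegree E n ↔ f.Monic ∧ f.natDegree = n := by
  simp [monicsOfDegree]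

theorem mem_monicIrreducibles {n : ℕ} (hn : n ≠ 0) {P : E[X]} :
    P ∈ monicIrreducibles E n ↔ P.Monic ∧ Irreducible P ∧ P.natDegree ∣ n := by
  simp only [monicIrreducibles, Finset.mem_filter, Finset.mem_biUnion, Finset.mem_range,
    mem_monicsOfDegree]
  constructor
  · rintro ⟨⟨d, -, h, -⟩, h'⟩
    exact ⟨h, h'⟩
  · rintro ⟨h, h'⟩
    exact ⟨⟨_, Nat.lt_succ_of_le (Nat.le_of_dvd (Nat.pos_of_ne_zero hn) h'.2), h, rfl⟩, h'⟩

omit [Finite E] in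
theorem pow_dvd_iff_le_count_normalizedFactors [DecidableEq E] {P f : E[X]} (hP : P.Monic)
    (hi : Irreducible P) (hf : f ≠ 0) (j : ℕ) :
    P ^ j ∣ f ↔ j ≤ (normalizedFactors f).count P := by
  rw [pow_dvd_iff_le_emultiplicity, emultiplicity_eq_count_normalizedFactors hi hf,
    hP.normalize_eq_self, Nat.cast_le]

open Classical in
-- The polynomial analogue of summing the von Mangoldt function over divisors: an irreducible P of
-- multiplicity c in f contributes deg P once for each power P^j with 1 ≤ j ≤ c. The pair (P, j) is
-- indexed by P and the degree k = j deg P of the power.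
theorem sum_natDegree_prime_power_divisors {n : ℕ} {f : E[X]} (hf : f ∈ monicsOfDegree E n) :
    ∑ k ∈ Finset.Icc 1 n, ∑ P ∈ monicIrreducibles E k,
      (if P ^ (k / P.natDegree) ∣ f then P.natDegree else 0) = n := by
  rw [mem_monicsOfDegree] at hf
  obtain ⟨hf, hn⟩ := hf
  have hm : ∀ P ∈ normalizedFactors f, P.Monic ∧ Irreducible P := fun P hP ↦ by
    have := irreducible_of_normalized_factor P hP
    exact ⟨normalize_normalized_factor P hP ▸ monic_normalize this.ne_zero, this⟩
  have key : ∑ P ∈ (normalizedFactors f).toFinset,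
      ∑ j ∈ Finset.Icc 1 ((normalizedFactors f).count P), P.natDegree = n := by
    have h := natDegree_multiset_prod_of_monic _ fun P hP ↦ (hm P hP).1
    rw [prod_normalizedFactors_eq hf.ne_zero, hf.normalize_eq_self, hn,
      Finset.sum_multiset_map_count] at h
    simp [h]
  simp_rw [← Finset.sum_filter]
  refine Eq.trans ?_ key
  rw [Finset.sum_sigma', Finset.sum_sigma']
  refine Finset.sum_bij' (fun x _ ↦ ⟨x.2, x.1 / x.2.natDegree⟩)
    (fun x _ ↦ ⟨x.2 * x.1.natDegree, x.1⟩) ?_ ?_ ?_ ?_ ?_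
  · rintro ⟨k, P⟩ h
    simp only [Finset.mem_sigma, Finset.mem_Icc, Finset.mem_filter] at h
    obtain ⟨⟨h1, hk⟩, hP, hd⟩ := h
    obtain ⟨hPm, hi, hdk⟩ := (mem_monicIrreducibles (by omega)).1 hP
    have hpos : 0 < k / P.natDegree :=
      Nat.div_pos (Nat.le_of_dvd (by omega) hdk) hi.natDegree_pos
    have hc := (pow_dvd_iff_le_count_normalizedFactors hPm hi hf.ne_zero _).1 hd
    simp only [Finset.mem_sigma, Multiset.mem_toFinset, Finset.mem_Icc]
    exact ⟨Multiset.count_pos.1 (hpos.trans_le hc), hpos, hc⟩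
  · rintro ⟨P, j⟩ h
    simp only [Finset.mem_sigma, Multiset.mem_toFinset, Finset.mem_Icc] at h
    obtain ⟨hP, h1, hc⟩ := h
    obtain ⟨hPm, hi⟩ := hm P hP
    have hd := (pow_dvd_iff_le_count_normalizedFactors hPm hi hf.ne_zero _).2 hc
    have hpos := hi.natDegree_pos
    have hle : j * P.natDegree ≤ n := by
      rw [← hn, ← natDegree_pow]
      exact natDegree_le_of_dvd hd hf.ne_zero
    have h0 : 1 ≤ j * P.natDegree := Nat.mul_pos h1 hpos
    simp only [Finset.mem_sigma, Finset.mem_Icc, Finset.mem_filter]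
    refine ⟨⟨h0, hle⟩, (mem_monicIrreducibles (by omega)).2 ⟨hPm, hi, Dvd.intro_left _ rfl⟩, ?_⟩
    rwa [Nat.mul_div_cancel _ hpos]
  · rintro ⟨k, P⟩ h
    simp only [Finset.mem_sigma, Finset.mem_Icc, Finset.mem_filter] at h
    obtain ⟨⟨h1, hk⟩, hP, hd⟩ := h
    obtain ⟨hPm, hi, hdk⟩ := (mem_monicIrreducibles (by omega)).1 hP
    simp [Nat.div_mul_cancel hdk]
  · rintro ⟨P, j⟩ h
    simp only [Finset.mem_sigma, Multiset.mem_toFinset, Finset.mem_Icc] at h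
    simp [Nat.mul_div_cancel _ (hm P h.1).2.natDegree_pos]
  · intros
    rfl

open Classical in
theorem filter_dvd_monicsOfDegree {n k : ℕ} {h : E[X]} (hh : h ∈ monicsOfDegree E k)
    (hk : k ≤ n) :
    (monicsOfDegree E n).filter (h ∣ ·) = (monicsOfDegree E (n - k)).image (h * ·) := by
  rw [mem_monicsOfDegree] at hh
  obtain ⟨hm, rfl⟩ := hh
  ext f
  simp only [Finset.mem_filter, mem_monicsOfDegree, Finset.mem_image]
  constructor
  · rintro ⟨⟨hf, rfl⟩, g, rfl⟩
    have hg := hm.of_mul_monic_left hf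
    exact ⟨g, ⟨hg, by rw [hm.natDegree_mul hg]; omega⟩, rfl⟩
  · rintro ⟨g, ⟨hg, hd⟩, rfl⟩
    exact ⟨⟨hm.mul hg, by rw [hm.natDegree_mul hg]; omega⟩, dvd_mul_right _ _⟩

variable {B : Type*} [CommRing B]

/-- The sum over the prime powers of degree `k` of the logarithmic coefficients of the Euler
product of a multiplicative function `lam` of monic polynomials. -/
noncomputable def primePowerSum (lam : E[X] → B) (k : ℕ) : B :=
  ∑ P ∈ monicIrreducibles E k, P.natDegree • lam P ^ (k / P.natDegree)

/-- **Newton's identities** for a multiplicative function of monic polynomials. -/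
theorem nsmul_sum_monicsOfDegree (lam : E[X] → B) (h1 : lam 1 = 1)
    (hmul : ∀ f g : E[X], f.Monic → g.Monic → lam (f * g) = lam f * lam g) (n : ℕ) :
    n • ∑ f ∈ monicsOfDegree E n, lam f = ∑ k ∈ Finset.Icc 1 n,
      primePowerSum lam k * ∑ g ∈ monicsOfDegree E (n - k), lam g := by
  classical
  have hpow : ∀ (f : E[X]) (j : ℕ), f.Monic → lam (f ^ j) = lam f ^ j := fun f j hf ↦ by
    induction j with
    | zero => simp [h1]
    | succ j ih => rw [pow_succ, hmul _ _ (hf.pow j) hf, ih, pow_succ]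
  calc n • ∑ f ∈ monicsOfDegree E n, lam f
      = ∑ f ∈ monicsOfDegree E n, ∑ k ∈ Finset.Icc 1 n, ∑ P ∈ monicIrreducibles E k,
          (if P ^ (k / P.natDegree) ∣ f then P.natDegree • lam f else 0) := by
        rw [Finset.smul_sum]
        refine Finset.sum_congr rfl fun f hf ↦ ?_
        -- The factor n is deg f, which is spread over the prime powers dividing f.
        conv_lhs => rw [← sum_natDegree_prime_power_divisors hf]
        simp_rw [Finset.sum_smul, ite_smul, zero_smul]
    _ = ∑ k ∈ Finset.Icc 1 n, ∑ P ∈ monicIrreducibles E k, ∑ f ∈ monicsOfDegree E n,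
          (if P ^ (k / P.natDegree) ∣ f then P.natDegree • lam f else 0) := by
        rw [Finset.sum_comm]
        exact Finset.sum_congr rfl fun k _ ↦ Finset.sum_comm
    _ = _ := by
        refine Finset.sum_congr rfl fun k hk ↦ ?_
        rw [Finset.mem_Icc] at hk
        rw [primePowerSum, Finset.sum_mul]
        refine Finset.sum_congr rfl fun P hP ↦ ?_
        obtain ⟨hPm, hi, hdk⟩ := (mem_monicIrreducibles (by omega)).1 hP
        have hQ : P ^ (k / P.natDegree) ∈ monicsOfDegree E k := by
          rw [mem_monicsOfDegree, natDegree_pow, Nat.div_mul_cancel hdk]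
          exact ⟨hPm.pow _, rfl⟩
        -- The multiples of Q = P^(k / deg P) are the products Qg with g monic of degree n - k, and
        -- multiplicativity splits off the factor from Q.
        rw [← Finset.sum_filter, filter_dvd_monicsOfDegree hQ hk.2, Finset.sum_image
          fun a _ b _ h ↦ mul_left_cancel₀ (hPm.pow _).ne_zero h, Finset.mul_sum]
        refine Finset.sum_congr rfl fun g hg ↦ ?_
        rw [hmul _ _ (hPm.pow _) (mem_monicsOfDegree.1 hg).1, hpow _ _ hPm, smul_mul_assoc]

end MonicPolynomials

/-! ### The Hasse–Davenport relation via an L-function -/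

section HasseDavenport

open Polynomial IntermediateField

variable {E : Type*} [Field E]

/-- The multiplicative function `f ↦ ψ(-c_{n-1}) χ((-1)^n c_0)` of monic polynomials
`f = X^n + c_{n-1} X^{n-1} + ⋯ + c_0`. -/
noncomputable def gaussCoeff {B : Type*} [CommRing B] [Algebra ℂ B] (ψ : AddChar E ℂ)
    (χ : E →* B) (f : E[X]) : B :=
  ψ (-f.nextCoeff) • χ ((-1) ^ f.natDegree * f.coeff 0)

variable {B : Type*} [CommRing B] [Algebra ℂ B] (ψ : AddChar E ℂ) (χ : E →* B)

theorem gaussCoeff_one : gaussCoeff ψ χ 1 = 1 := by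
  have : (1 : E[X]).nextCoeff = 0 := by simpa using nextCoeff_C_eq_zero (1 : E)
  simp [gaussCoeff, this]

theorem gaussCoeff_mul {f g : E[X]} (hf : f.Monic) (hg : g.Monic) :
    gaussCoeff ψ χ (f * g) = gaussCoeff ψ χ f * gaussCoeff ψ χ g := by
  rw [gaussCoeff, hf.nextCoeff_mul hg, hf.natDegree_mul hg, mul_coeff_zero, neg_add,
    AddChar.map_add_eq_mul, gaussCoeff, gaussCoeff, smul_mul_smul_comm, ← map_mul χ, pow_add,
    mul_mul_mul_comm]

/-- In E(a), norm and trace are read off the minimal polynomial; passing up to K raises the norm to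
the power [K : E(a)] and multiplies the trace by it. -/
theorem gaussCoeff_minpoly_pow {K : Type*} [Field K] [Algebra E K] [FiniteDimensional E K]
    (a : K) : gaussCoeff ψ χ (minpoly E a) ^ (Module.finrank E K / (minpoly E a).natDegree) =
      ψ (Algebra.trace E K a) • χ (Algebra.norm E a) := by
  have ha : IsIntegral E a := .of_finite E a
  have hd : Module.finrank E⟮a⟯ K = Module.finrank E K / (minpoly E a).natDegree := by
    rw [← adjoin.finrank ha, ← Module.finrank_mul_finrank E E⟮a⟯ K,
      Nat.mul_div_cancel_left _ Module.finrank_pos]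
  have hn := Algebra.PowerBasis.norm_gen_eq_coeff_zero_minpoly (adjoin.powerBasis ha)
  have ht := PowerBasis.trace_gen_eq_nextCoeff_minpoly (adjoin.powerBasis ha)
  rw [adjoin.powerBasis_gen, minpoly_gen] at hn ht
  rw [Algebra.norm_eq_norm_adjoin, trace_eq_trace_adjoin, hn, ht, hd, gaussCoeff,
    _root_.smul_pow, map_pow, AddChar.map_nsmul_eq_pow, adjoin.powerBasis_dim]

variable [Finite E]

/-- The degree condition makes P divide X^|K| - X, so P splits in K; it is separable because E is
perfect. -/
theorem card_filter_minpoly_eq {K : Type*} [Field K] [Fintype K] [Algebra E K] [DecidableEq E[X]]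
    {P : E[X]} (hm : P.Monic) (hi : Irreducible P) (hd : P.natDegree ∣ Module.finrank E K) :
    (Finset.univ.filter fun a : K ↦ minpoly E a = P).card = P.natDegree := by
  classical
  have hd' : P ∣ X ^ Fintype.card K - X := by
    have h := hi.natDegree_dvd_iff_dvd_X_pow_card_pow_sub_X.1 hd
    rwa [← Module.natCard_eq_pow_finrank, Nat.card_eq_fintype_card] at h
  have hsp := FiniteField.isSplittingField_sub K E
  have h0 : (X ^ Fintype.card K - X : E[X]) ≠ 0 :=
    FiniteField.X_pow_card_sub_X_ne_zero _ Fintype.one_lt_card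
  have hs : (P.map (algebraMap E K)).Splits :=
    hsp.splits.of_dvd (Polynomial.map_ne_zero h0) (Polynomial.map_dvd _ hd')
  have hsep : P.Separable := PerfectField.separable_of_irreducible hi
  rw [← card_rootSet_eq_natDegree hsep hs, ← Set.toFinset_card]
  congr 1
  ext a
  simp only [Finset.mem_filter, Finset.mem_univ, true_and, Set.mem_toFinset, mem_rootSet]
  constructor
  · rintro rfl
    exact ⟨hm.ne_zero, minpoly.aeval E a⟩
  · rintro ⟨-, h⟩
    exact (minpoly.eq_of_irreducible_of_monic hi h hm).symm

/-- Grouping the elements of K by minimal polynomial identifies a Gauss sum over K with a power sum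
of the L-function. -/
theorem sum_trace_smul_norm_eq_primePowerSum (K : Type*) [Field K] [Fintype K] [Algebra E K] :
    ∑ a : K, ψ (Algebra.trace E K a) • χ (Algebra.norm E a) =
      primePowerSum (gaussCoeff ψ χ) (Module.finrank E K) := by
  classical
  have : FiniteDimensional E K := .of_finite
  have hmem : ∀ a ∈ (Finset.univ : Finset K),
      minpoly E a ∈ monicIrreducibles E (Module.finrank E K) := fun a _ ↦
    (mem_monicIrreducibles Module.finrank_pos.ne').2 ⟨minpoly.monic (.of_finite E a),
      minpoly.irreducible (.of_finite E a), minpoly.degree_dvd (.of_finite E a)⟩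
  rw [← Finset.sum_fiberwise_of_maps_to hmem, primePowerSum]
  refine Finset.sum_congr rfl fun P hP ↦ ?_
  obtain ⟨hm, hi, hd⟩ := (mem_monicIrreducibles Module.finrank_pos.ne').1 hP
  trans ∑ a : K with minpoly E a = P,
    gaussCoeff ψ χ P ^ (Module.finrank E K / P.natDegree)
  swap
  · rw [Finset.sum_const, card_filter_minpoly_eq hm hi hd]
  refine Finset.sum_congr rfl fun a ha ↦ ?_
  rw [← (Finset.mem_filter.1 ha).2, gaussCoeff_minpoly_pow]

/-- Translating the coefficient of X^(n-1) permutes the monic polynomials of degree n and multiplies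
the sum by a value ψ(t) ≠ 1. For n ≥ 2 this leaves the constant term, and hence the χ factor,
untouched. -/
theorem sum_gaussCoeff_monicsOfDegree_eq_zero {ψ : AddChar E ℂ} (hψ : ψ ≠ 1) {n : ℕ}
    (hn : 2 ≤ n) : ∑ f ∈ monicsOfDegree E n, gaussCoeff ψ χ f = 0 := by
  obtain ⟨t, ht⟩ := AddChar.ne_one_iff.1 hψ
  have hlt : ∀ u : E, (C u * X ^ (n - 1)).degree < (n : WithBot ℕ) := fun u ↦
    (degree_C_mul_X_pow_le _ _).trans_lt (by exact_mod_cast Nat.sub_lt (by omega) one_pos)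
  have hmem : ∀ f ∈ monicsOfDegree E n, ∀ u : E,
      f + C u * X ^ (n - 1) ∈ monicsOfDegree E n := fun f hf u ↦ by
    obtain ⟨hm, rfl⟩ := mem_monicsOfDegree.1 hf
    have h := degree_eq_natDegree hm.ne_zero ▸ hlt u
    exact mem_monicsOfDegree.2 ⟨hm.add_of_left h, natDegree_add_eq_left_of_degree_lt h⟩
  have hval : ∀ f ∈ monicsOfDegree E n,
      gaussCoeff ψ χ (f + C (-t) * X ^ (n - 1)) = ψ t • gaussCoeff ψ χ f := fun f hf ↦ by
    have h1 := (mem_monicsOfDegree.1 hf).2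
    have h2 := (mem_monicsOfDegree.1 (hmem f hf (-t))).2
    have h3 : (0 : ℕ) ≠ n - 1 := by omega
    rw [gaussCoeff, gaussCoeff, nextCoeff_of_natDegree_pos (by omega),
      nextCoeff_of_natDegree_pos (by omega), h1, h2, smul_smul, ← AddChar.map_add_eq_mul]
    simp [coeff_X_pow, h3]
  have hsum : ∑ f ∈ monicsOfDegree E n, gaussCoeff ψ χ f =
      ψ t • ∑ f ∈ monicsOfDegree E n, gaussCoeff ψ χ f := by
    rw [Finset.smul_sum, ← Finset.sum_congr rfl hval]
    refine (Finset.sum_bij' (fun f _ ↦ f + C (-t) * X ^ (n - 1))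
      (fun f _ ↦ f + C t * X ^ (n - 1)) (fun f hf ↦ hmem f hf _) (fun f hf ↦ hmem f hf _)
      ?_ ?_ fun _ _ ↦ rfl).symm <;> intros <;> simp
  have h := sub_eq_zero.2 hsum
  nth_rw 1 [← one_smul ℂ (∑ f ∈ monicsOfDegree E n, gaussCoeff ψ χ f)] at h
  rw [← sub_smul] at h
  have h' := congrArg ((1 - ψ t)⁻¹ • ·) h
  simpa [smul_smul, inv_mul_cancel₀ (sub_ne_zero.2 (Ne.symm ht))] using h'

theorem sum_gaussCoeff_monicsOfDegree_zero :
    ∑ f ∈ monicsOfDegree E 0, gaussCoeff ψ χ f = 1 := by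
  have : monicsOfDegree E 0 = {1} := by
    ext f
    simp only [mem_monicsOfDegree, Finset.mem_singleton]
    refine ⟨fun h ↦ h.1.natDegree_eq_zero.1 h.2, ?_⟩
    rintro rfl
    exact ⟨monic_one, natDegree_one⟩
  rw [this, Finset.sum_singleton, gaussCoeff_one]

theorem sum_gaussCoeff_monicsOfDegree_one [Fintype E] :
    ∑ f ∈ monicsOfDegree E 1, gaussCoeff ψ χ f = ∑ u : E, ψ u • χ u := by
  refine (Finset.sum_bij (fun u _ ↦ X - C u) ?_ ?_ ?_ ?_).symm
  · intro u _
    exact mem_monicsOfDegree.2 ⟨monic_X_sub_C u, natDegree_X_sub_C u⟩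
  · intro u _ v _ h
    simpa using h
  · intro f hf
    obtain ⟨hm, hd⟩ := mem_monicsOfDegree.1 hf
    refine ⟨-f.coeff 0, Finset.mem_univ _, ?_⟩
    rw [eq_X_add_C_of_natDegree_le_one hd.le, ← hd, hm.coeff_natDegree]
    simp
  · intro u _
    simp [gaussCoeff]

/-- The **Hasse–Davenport relation** between extensions of consecutive degrees. -/
theorem hasseDavenport_succ [Fintype E] {ψ : AddChar E ℂ} (hψ : ψ ≠ 1)
    (K L : Type*) [Field K] [Fintype K] [Algebra E K] [Field L] [Fintype L] [Algebra E L]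
    (h : Module.finrank E L = Module.finrank E K + 1) :
    ∑ b : L, ψ (Algebra.trace E L b) • χ (Algebra.norm E b) =
      -((∑ u : E, ψ u • χ u) * ∑ a : K, ψ (Algebra.trace E K a) • χ (Algebra.norm E a)) := by
  have : FiniteDimensional E K := .of_finite
  have hpos : 0 < Module.finrank E K := Module.finrank_pos
  rw [sum_trace_smul_norm_eq_primePowerSum, sum_trace_smul_norm_eq_primePowerSum, h]
  set n := Module.finrank E K
  have key := nsmul_sum_monicsOfDegree (gaussCoeff ψ χ) (gaussCoeff_one ψ χ)
    (fun f g ↦ gaussCoeff_mul ψ χ) (n + 1)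
  -- In Newton's identity of degree n + 1 the left side vanishes, and on the right only k = n + 1
  -- and k = n survive.
  rw [sum_gaussCoeff_monicsOfDegree_eq_zero χ hψ (by omega), smul_zero,
    Finset.sum_Icc_succ_top (by omega), ← Finset.sum_subset (Finset.singleton_subset_iff.2
      (Finset.mem_Icc.2 ⟨hpos, le_rfl⟩)), Finset.sum_singleton, Nat.sub_self,
    Nat.add_sub_cancel_left, sum_gaussCoeff_monicsOfDegree_zero,
    sum_gaussCoeff_monicsOfDegree_one] at key
  · rw [eq_neg_iff_add_eq_zero, mul_comm, add_comm, key, mul_one]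
  · intro k hk hk'
    rw [Finset.mem_Icc] at hk
    rw [Finset.mem_singleton] at hk'
    rw [sum_gaussCoeff_monicsOfDegree_eq_zero χ hψ (by omega), mul_zero]

/-- Hasse–Davenport is applied to the universal multiplicative map from E to its monoid algebra, and
h is extended linearly. This covers every function h, including its value at 0, with no expansion in
multiplicative characters. -/
theorem sum_norm_trace_succ [Fintype E] {ψ : AddChar E ℂ} (hψ : ψ ≠ 1)
    (K L : Type*) [Field K] [Fintype K] [Algebra E K] [Field L] [Fintype L] [Algebra E L]
    (hd : Module.finrank E L = Module.finrank E K + 1) (h : E → ℂ) :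
    ∑ b : L, h (Algebra.norm E b) * ψ (Algebra.trace E L b) =
      -∑ u : E, ∑ a : K, h (u * Algebra.norm E a) * (ψ u * ψ (Algebra.trace E K a)) := by
  let φ : MonoidAlgebra ℂ E →ₗ[ℂ] ℂ :=
    Finsupp.linearCombination ℂ h ∘ₗ (MonoidAlgebra.coeffLinearEquiv ℂ).toLinearMap
  have hφ : ∀ x : E, φ (MonoidAlgebra.of ℂ E x) = h x := fun x ↦ by simp [φ]
  have key := congrArg φ (hasseDavenport_succ (MonoidAlgebra.of ℂ E) hψ K L hd)
  simp_rw [Finset.sum_mul_sum, smul_mul_smul_comm, ← map_mul (MonoidAlgebra.of ℂ E), map_neg,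
    map_sum, map_smul, hφ, smul_eq_mul] at key
  simpa only [mul_comm (h _)] using key

end HasseDavenport

/-! ### Character criterion for partial difference sets -/

section PartialDifferenceSet

open Classical in
/-- A symmetric subset of a finite abelian group whose character sums satisfy the quadratic
equation of a partial difference set is a partial difference set. The characters range over a
family large enough to separate `0` from the other elements. -/
theorem isPDS_of_sum_addChar {G : Type*} [AddCommGroup G] [Fintype G] {ι : Type*} [Fintype ι]
    [Nonempty ι] (φ : ι → AddChar G ℂ) (hφ : ∀ g : G, g ≠ 0 → ∑ i, φ i g = 0) {D : Set G}
    (h0 : (0 : G) ∉ D) (hneg : ∀ g : G, -g ∈ D ↔ g ∈ D) {k lam mu : ℕ} (hk : D.ncard = k)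
    (hD : ∀ i, (∑ g, if g ∈ D then φ i g else 0) ^ 2 =
      k + lam * (∑ g, if g ∈ D then φ i g else 0) +
        mu * (∑ g, φ i g - 1 - ∑ g, if g ∈ D then φ i g else 0)) :
    IsPDS D (Fintype.card G) k lam mu := by
  let S : G → Finset (G × G) := fun x ↦
    Finset.univ.filter fun z ↦ z.1 ∈ D ∧ z.2 ∈ D ∧ z.1 - z.2 = x
  -- The defect: the number of representations as a difference minus the number prescribed by k at
  -- 0, λ on D and μ elsewhere. All its character sums vanish, so inversion forces it to be zero.
  let f : G → ℂ := fun x ↦ (S x).card -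
    ((if x = 0 then (k : ℂ) else 0) + lam * (if x ∈ D then 1 else 0) +
      mu * (1 - (if x = 0 then 1 else 0) - (if x ∈ D then 1 else 0)))
  have hf : ∀ i, ∑ x, f x * φ i x = 0 := fun i ↦ by
    have h1 : ∑ x, ((S x).card : ℂ) * φ i x = (∑ g, if g ∈ D then φ i g else 0) ^ 2 := by
      -- By symmetry of D, one factor of the square can be summed over -g, so that the square counts
      -- differences rather than sums.
      have hinv : (∑ g, if g ∈ D then φ i g else 0) = ∑ g, if g ∈ D then φ i (-g) else 0 := by
        rw [← Equiv.sum_comp (Equiv.neg G)]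
        simp [hneg]
      rw [sq]
      nth_rw 2 [hinv]
      rw [Finset.sum_mul_sum, ← Finset.sum_product', Finset.univ_product_univ]
      have h2 : ∀ z : G × G, ((if z.1 ∈ D then φ i z.1 else 0) *
          if z.2 ∈ D then φ i (-z.2) else 0) =
          if z.1 ∈ D ∧ z.2 ∈ D then φ i (z.1 - z.2) else 0 := fun z ↦ by
        rw [sub_eq_add_neg, AddChar.map_add_eq_mul]
        by_cases a : z.1 ∈ D <;> by_cases b : z.2 ∈ D <;> simp [a, b]
      simp_rw [h2]
      rw [← Finset.sum_fiberwise (s := Finset.univ) (g := fun z : G × G ↦ z.1 - z.2)]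
      refine Finset.sum_congr rfl fun x _ ↦ ?_
      rw [← Finset.sum_filter, Finset.filter_filter, ← nsmul_eq_mul, ← Finset.sum_const]
      have : S x = Finset.univ.filter fun z : G × G ↦ z.1 - z.2 = x ∧ z.1 ∈ D ∧ z.2 ∈ D := by
        ext z
        simp only [S, Finset.mem_filter, Finset.mem_univ, true_and]
        tauto
      rw [← this]
      refine Finset.sum_congr rfl fun z hz ↦ ?_
      rw [(Finset.mem_filter.1 hz).2.2.2]
    simp only [f, sub_mul, add_mul, Finset.sum_sub_distrib, Finset.sum_add_distrib, h1, hD i,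
      mul_assoc, ite_mul, zero_mul, one_mul, Finset.sum_ite_eq', Finset.mem_univ, if_true,
      ← Finset.mul_sum, AddChar.map_zero_eq_one, mul_one]
    ring
  have hf0 : ∀ y, f y = 0 := fun y ↦ by
    have h1 : ∑ i, ∑ x, f x * φ i x * φ i (-y) = 0 := by
      simp_rw [← Finset.sum_mul, hf, zero_mul, Finset.sum_const_zero]
    rw [Finset.sum_comm] at h1
    simp_rw [mul_assoc, ← AddChar.map_add_eq_mul, ← Finset.mul_sum, ← sub_eq_add_neg] at h1
    rw [Finset.sum_eq_single y (fun x _ hx ↦ by rw [hφ _ (sub_ne_zero.2 hx), mul_zero])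
      (by simp)] at h1
    simpa using h1
  have hS : ∀ x, x ≠ 0 →
      {z : G × G | z.1 ∈ D ∧ z.2 ∈ D ∧ z.1 ≠ z.2 ∧ z.1 - z.2 = x}.ncard = (S x).card := by
    intro x hx
    rw [← Set.ncard_coe_finset]
    congr 1
    ext z
    simp only [S, Set.mem_ofPred_eq, Finset.coe_filter, Finset.mem_univ, true_and]
    refine ⟨fun h ↦ ⟨h.1, h.2.1, h.2.2.2⟩, fun h ↦ ⟨h.1, h.2.1, ?_, h.2.2⟩⟩
    rintro hz
    exact hx (by rw [← h.2.2, hz, sub_self])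
  refine ⟨Nat.card_eq_fintype_card, hk, h0, fun x hx ↦ ?_, fun x hx hxD ↦ ?_⟩
  · have hx0 : x ≠ 0 := fun h ↦ h0 (h ▸ hx)
    have := hf0 x
    simp only [f, hx, hx0, if_true, if_false] at this
    rw [hS x hx0]
    have h' : ((S x).card : ℂ) = lam := by linear_combination this
    exact_mod_cast h'
  · have := hf0 x
    simp only [f, hx, hxD, if_false] at this
    rw [hS x hx]
    have h' : ((S x).card : ℂ) = mu := by linear_combination this
    exact_mod_cast h'

end PartialDifferenceSet

/-! ### Sums over norm fibres and over subgroups -/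

section NormSums

variable {E : Type*} [Field E] [Fintype E]

open Classical in
theorem sum_eq_add_sum_units {K M : Type*} [Field K] [Fintype K] [AddCommMonoid M] (f : K → M) :
    ∑ a, f a = f 0 + ∑ a : Kˣ, f a := by
  rw [← Finset.add_sum_erase _ _ (Finset.mem_univ (0 : K))]
  congr 1
  refine (Finset.sum_bij' (fun (a : Kˣ) _ ↦ (a : K))
    (fun a ha ↦ Units.mk0 a (Finset.ne_of_mem_erase ha)) ?_ ?_ ?_ ?_ ?_).symm <;> simp

open Classical in
-- The norm is a surjective homomorphism on units, so all its fibres have the same size e.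
theorem sum_units_norm (K : Type*) [Field K] [Fintype K] [Algebra E K] {e : ℕ}
    (he : e * (Fintype.card E - 1) = Fintype.card K - 1) (g : E → ℂ) :
    ∑ a : Kˣ, g (Algebra.norm E (a : K)) = e * ∑ y : Eˣ, g y := by
  let N : Kˣ →* Eˣ := Units.map (Algebra.norm E)
  have hN : Function.Surjective N := FiniteField.unitsMap_norm_surjective E K
  have hc : ∀ y : Eˣ, (Finset.univ.filter fun a ↦ N a = y).card =
      (Finset.univ.filter fun a ↦ N a = 1).card := fun y ↦
    MonoidHom.card_fiber_eq_of_mem_range N (hN y) (hN 1)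
  have he' : (Finset.univ.filter fun a ↦ N a = 1).card = e := by
    have h1 := Finset.card_eq_sum_card_fiberwise (f := N) (s := Finset.univ) (t := Finset.univ)
      (by simp)
    simp_rw [hc, Finset.sum_const, Finset.card_univ, Fintype.card_units, smul_eq_mul] at h1
    rw [← he, mul_comm] at h1
    exact (Nat.eq_of_mul_eq_mul_left (Nat.sub_pos_of_lt Fintype.one_lt_card) h1).symm
  rw [← Finset.sum_fiberwise (s := Finset.univ) (g := N), Finset.mul_sum]
  refine Finset.sum_congr rfl fun y _ ↦ ?_
  rw [← he', ← hc y, ← nsmul_eq_mul, ← Finset.sum_const]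
  refine Finset.sum_congr rfl fun a ha ↦ ?_
  rw [← (Finset.mem_filter.1 ha).2]
  rfl

variable {ψ : AddChar E ℂ} (hψ : ψ ≠ 1)
include hψ

open Classical in
theorem sum_addChar_units {y : E} (hy : y ≠ 0) : ∑ u : Eˣ, ψ (u * y) = -1 := by
  have h := AddChar.sum_mulShift y (AddChar.IsPrimitive.of_ne_one hψ)
  rw [sum_eq_add_sum_units, if_neg hy] at h
  simp only [zero_mul, AddChar.map_zero_eq_one, Nat.cast_zero] at h
  linear_combination h

open Classical in
theorem sum_addChar_trace_mul (K : Type*) [Field K] [Fintype K] [Algebra E K] (c : K) :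
    ∑ a : K, ψ (Algebra.trace E K (c * a)) = if c = 0 then (Fintype.card K : ℂ) else 0 := by
  have : FiniteDimensional E K := .of_finite
  have hne : ψ.compAddMonoidHom (Algebra.trace E K).toAddMonoidHom ≠ 1 := by
    obtain ⟨t, ht⟩ := AddChar.ne_one_iff.1 hψ
    obtain ⟨a, rfl⟩ := Algebra.trace_surjective E K t
    exact AddChar.ne_one_iff.2 ⟨a, ht⟩
  have h := AddChar.sum_mulShift c (AddChar.IsPrimitive.of_ne_one hne)
  simp only [AddChar.compAddMonoidHom_apply, LinearMap.toAddMonoidHom_coe, mul_comm _ c] at h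
  rw [h]
  split_ifs <;> simp

open Classical in
theorem sum_units_addChar_trace_mul (K : Type*) [Field K] [Fintype K] [Algebra E K] {c : K}
    (hc : c ≠ 0) : ∑ a : Kˣ, ψ (Algebra.trace E K (c * a)) = -1 := by
  have h := sum_addChar_trace_mul hψ K c
  rw [sum_eq_add_sum_units, if_neg hc] at h
  simp only [mul_zero, map_zero, AddChar.map_zero_eq_one] at h
  linear_combination h

omit hψ in
open Classical in
-- The range of summation is the additive subgroup y⁻¹R, on which ψ is either trivial or sums to 0.
-- This dichotomy is the source of the two eigenvalues.
theorem sum_addChar_mul_mem (R : AddSubgroup E) {y : E} (hy : y ≠ 0) :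
    (∑ u : E, if u * y ∈ R then ψ u else 0) = 0 ∨
    (∑ u : E, if u * y ∈ R then ψ u else 0) = Nat.card R := by
  by_cases h : ∀ u, u * y ∈ R → ψ u = 1
  · right
    rw [Finset.sum_congr rfl fun u _ ↦ (by
      split_ifs with hu
      · exact h u hu
      · rfl : (if u * y ∈ R then ψ u else 0) = if u * y ∈ R then 1 else 0)]
    have hs := Equiv.sum_comp (Equiv.mulRight₀ y hy) fun u ↦ if u ∈ R then (1 : ℂ) else 0
    simp only [Equiv.mulRight₀_apply] at hs
    rw [hs, Finset.sum_boole, Nat.card_eq_fintype_card]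
    congr 1
    exact (Fintype.card_subtype _).symm
  · left
    push Not at h
    obtain ⟨t, ht, ht1⟩ := h
    have key : (∑ u : E, if u * y ∈ R then ψ u else 0) =
        ψ t * ∑ u : E, if u * y ∈ R then ψ u else 0 := by
      nth_rw 1 [← Equiv.sum_comp (Equiv.addLeft t)]
      rw [Finset.mul_sum]
      refine Finset.sum_congr rfl fun u _ ↦ ?_
      simp [add_mul, R.add_mem_cancel_left ht, AddChar.map_add_eq_mul]
    have : (1 - ψ t) * (∑ u : E, if u * y ∈ R then ψ u else 0) = 0 := by
      linear_combination key
    exact (mul_eq_zero.1 this).resolve_left (sub_ne_zero.2 (Ne.symm ht1))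

end NormSums

/-! ### Character sums of the norm set -/

section NormSet

variable {E : Type*} [Field E] [Fintype E]

/-- The pairs `(a, b)` with `a ≠ 0` and `N(b) / N(a) ∈ R`. -/
def normSet (K L : Type*) [Field K] [Algebra E K] [Field L] [Algebra E L] (R : AddSubgroup E) :
    Set (K × L) :=
  {z | z.1 ≠ 0 ∧ Algebra.norm E z.2 / Algebra.norm E z.1 ∈ R}

open Classical in
/-- The character sums of `normSet K L R`. -/
noncomputable def normSetCharSum (ψ : AddChar E ℂ) {K L : Type*} [Field K] [Fintype K]
    [Algebra E K] [Field L] [Fintype L] [Algebra E L] (R : AddSubgroup E) (c : K) (d : L) : ℂ :=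
  ∑ a : Kˣ, ∑ b : L, if Algebra.norm E b / Algebra.norm E (a : K) ∈ R then
    ψ (Algebra.trace E K (c * a)) * ψ (Algebra.trace E L (d * b)) else 0

variable (R : AddSubgroup E) {x : ℕ} (hR : Nat.card R = x + 1)

section
include hR

omit hR in
open Classical in
theorem sum_units_div_mem (y : Eˣ) (f : E → ℂ) :
    (∑ z : Eˣ, if (y : E) / z ∈ R then f (y / z) else 0) =
      (∑ u : E, if u ∈ R then f u else 0) - f 0 := by
  rw [sum_eq_add_sum_units (K := E), if_pos R.zero_mem,
    ← Equiv.sum_comp ((Equiv.inv Eˣ).trans (Equiv.mulLeft y))]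
  simp [div_eq_mul_inv, mul_left_comm (y : E)]

open Classical in
theorem sum_mem_one : (∑ u : E, if u ∈ R then (1 : ℂ) else 0) = x + 1 := by
  rw [Finset.sum_boole, ← Fintype.card_subtype]
  exact_mod_cast (Nat.card_eq_fintype_card (α := R)).symm.trans hR

open Classical in
theorem sum_units_norm_div_mem (K : Type*) [Field K] [Fintype K] [Algebra E K] {e : ℕ}
    (he : e * (Fintype.card E - 1) = Fintype.card K - 1) (y : Eˣ) :
    (∑ a : Kˣ, if (y : E) / Algebra.norm E (a : K) ∈ R then (1 : ℂ) else 0) = e * x := by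
  rw [sum_units_norm K he fun z ↦ if (y : E) / z ∈ R then (1 : ℂ) else 0,
    sum_units_div_mem R y fun _ ↦ 1, sum_mem_one R hR, add_sub_cancel_right]

open Classical in
theorem sum_norm_div_mem (L : Type*) [Field L] [Fintype L] [Algebra E L] {e' : ℕ}
    (he' : e' * (Fintype.card E - 1) = Fintype.card L - 1) (y : Eˣ) :
    (∑ b : L, if Algebra.norm E b / (y : E) ∈ R then (1 : ℂ) else 0) = 1 + e' * x := by
  have : FiniteDimensional E L := .of_finite
  rw [sum_eq_add_sum_units, Algebra.norm_zero, zero_div, if_pos R.zero_mem,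
    sum_units_norm L he' fun z ↦ if z / (y : E) ∈ R then (1 : ℂ) else 0]
  congr 2
  have h := sum_mem_one R hR
  rw [sum_eq_add_sum_units, if_pos R.zero_mem] at h
  rw [← Equiv.sum_comp (Equiv.mulRight y)]
  simp only [Equiv.coe_mulRight, Units.val_mul, ne_eq, Units.ne_zero, not_false_eq_true,
    mul_div_cancel_right₀]
  linear_combination h

end

variable {K L : Type*} [Field K] [Fintype K] [Algebra E K] [Field L] [Fintype L] [Algebra E L]
  {e e' : ℕ} (he : e * (Fintype.card E - 1) = Fintype.card K - 1)
  (he' : e' * (Fintype.card E - 1) = Fintype.card L - 1)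

omit [Fintype E] in
theorem norm_unit_ne_zero (a : Kˣ) : Algebra.norm E (a : K) ≠ 0 := by
  have : FiniteDimensional E K := .of_finite
  exact Algebra.norm_ne_zero_iff.2 a.ne_zero

section
include hR

open Classical in
include he' in
-- For every a, the number of admissible b is 1 + e'x: b = 0 and e' elements for each nonzero
-- element of R.
theorem normSetCharSum_right_zero (ψ : AddChar E ℂ) (c : K) :
    normSetCharSum ψ R c (0 : L) =
      (1 + e' * x) * ∑ a : Kˣ, ψ (Algebra.trace E K (c * a)) := by
  classical
  rw [normSetCharSum, Finset.mul_sum]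
  refine Finset.sum_congr rfl fun a _ ↦ ?_
  have h := sum_norm_div_mem R hR L he' (Units.mk0 _ (norm_unit_ne_zero a))
  rw [Units.val_mk0] at h
  rw [← h, Finset.sum_mul]
  simp

include he in
-- The terms with b = 0 give |K| - 1. Each b ≠ 0 admits ex values of a, and the nontrivial character
-- sums to -1 over the units of L.
theorem normSetCharSum_left_zero {ψ : AddChar E ℂ} (hψ : ψ ≠ 1) {d : L} (hd : d ≠ 0) :
    normSetCharSum ψ R (0 : K) d = Fintype.card K - 1 - x * e := by
  classical
  have : FiniteDimensional E L := .of_finite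
  have h : ∀ b : Lˣ, (∑ a : Kˣ, if Algebra.norm E (b : L) / Algebra.norm E (a : K) ∈ R then
      ψ (Algebra.trace E L (d * b)) else 0) = e * x * ψ (Algebra.trace E L (d * b)) := fun b ↦ by
    have h := sum_units_norm_div_mem R hR K he (Units.mk0 _ (norm_unit_ne_zero b))
    rw [Units.val_mk0] at h
    rw [← h, Finset.sum_mul]
    simp
  simp only [normSetCharSum, zero_mul, map_zero, AddChar.map_zero_eq_one, one_mul]
  rw [Finset.sum_comm, sum_eq_add_sum_units]
  simp_rw [h]
  rw [← Finset.mul_sum, sum_units_addChar_trace_mul hψ L hd]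
  simp only [map_zero, Algebra.norm_zero, zero_div, R.zero_mem, if_true, mul_zero, AddChar.map_zero_eq_one,
    Finset.sum_const, Finset.card_univ, Fintype.card_units, nsmul_eq_mul,
    Nat.cast_sub Fintype.card_pos]
  push_cast
  ring

open Classical in
include he in
-- The term t = 0 is a full sum of ψ, hence 0. For t ≠ 0 put v = u N(t)/y ∈ R: summing over t, v = 0
-- gives |K| - 1 and each of the x nonzero v gives -e.
theorem sum_sum_addChar_mul_norm_mem {ψ : AddChar E ℂ} (hψ : ψ ≠ 1) (y : Eˣ) :
    (∑ t : K, ∑ u : E, if u * Algebra.norm E t / y ∈ R then ψ u else 0) =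
      Fintype.card K - 1 - x * e := by
  have : FiniteDimensional E K := .of_finite
  rw [sum_eq_add_sum_units]
  simp only [Algebra.norm_zero, mul_zero, zero_div, R.zero_mem, if_true]
  have h0 : ∑ u : E, ψ u = 0 := AddChar.sum_eq_zero_of_ne_one hψ
  have h1 : ∀ t : Kˣ, (∑ u : E, if u * Algebra.norm E (t : K) / y ∈ R then ψ u else 0) =
      ∑ v : E, if v ∈ R then ψ (v * y / Algebra.norm E (t : K)) else 0 := fun t ↦ by
    have ht := norm_unit_ne_zero (E := E) t
    rw [← Equiv.sum_comp (Equiv.mulRight₀ ((y : E) / Algebra.norm E (t : K))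
      (div_ne_zero y.ne_zero ht))]
    refine Finset.sum_congr rfl fun v _ ↦ ?_
    simp only [Equiv.mulRight₀_apply]
    rw [← mul_div_assoc, div_mul_cancel₀ _ ht,
      mul_div_cancel_right₀ _ y.ne_zero]
  have h2 : ∀ v : E, v ≠ 0 → ∑ t : Kˣ, ψ (v * y / Algebra.norm E (t : K)) = -e := fun v hv ↦ by
    rw [sum_units_norm K he fun z ↦ ψ (v * y / z), ← Equiv.sum_comp (Equiv.inv Eˣ)]
    have := sum_addChar_units hψ (mul_ne_zero hv y.ne_zero)
    simp only [Equiv.inv_apply, Units.val_inv_eq_inv_val, div_inv_eq_mul]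
    simp_rw [mul_comm (v * (y : E)), this]
    ring
  have h3 := sum_mem_one R hR
  rw [sum_eq_add_sum_units, if_pos R.zero_mem] at h3
  rw [h0, zero_add, Finset.sum_congr rfl fun t _ ↦ h1 t, Finset.sum_comm, sum_eq_add_sum_units]
  have h4 : ∀ v : Eˣ, (∑ t : Kˣ, if (v : E) ∈ R then
      ψ (v * y / Algebra.norm E (t : K)) else 0) = -e * if (v : E) ∈ R then 1 else 0 := fun v ↦ by
    split_ifs
    · rw [h2 v v.ne_zero, mul_one]
    · simp
  simp_rw [h4]
  rw [← Finset.mul_sum]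
  simp only [R.zero_mem, if_true, zero_mul, zero_div, AddChar.map_zero_eq_one, Finset.sum_const,
    Finset.card_univ, Fintype.card_units, nsmul_eq_mul, mul_one, Nat.cast_sub Fintype.card_pos]
  push_cast
  linear_combination -(e : ℂ) * h3

include he in
theorem normSetCharSum_of_ne_zero {ψ : AddChar E ℂ} (hψ : ψ ≠ 1)
    (hd : Module.finrank E L = Module.finrank E K + 1) {c : K} {d : L} (hc : c ≠ 0) (hd0 : d ≠ 0) :
    normSetCharSum ψ R c d = Fintype.card K - 1 - x * e ∨
      normSetCharSum ψ R c d = Fintype.card K - 1 - x * e - Fintype.card K * (x + 1) := by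
  classical
  have : FiniteDimensional E K := .of_finite
  have : FiniteDimensional E L := .of_finite
  have hNd : Algebra.norm E d ≠ 0 := Algebra.norm_ne_zero_iff.2 hd0
  set y : Eˣ := Units.mk0 _ hNd
  have hNc : Algebra.norm E (-c) ≠ 0 := Algebra.norm_ne_zero_iff.2 (neg_ne_zero.2 hc)
  -- Rescaling b by d, applying Hasse–Davenport and replacing t by ta cancels N(a), so the
  -- membership condition no longer depends on a.
  have h1 : ∀ a : Kˣ, (∑ b : L, if Algebra.norm E b / Algebra.norm E (a : K) ∈ R then
      ψ (Algebra.trace E K (c * a)) * ψ (Algebra.trace E L (d * b)) else 0) =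
      -∑ u : E, ∑ t : K, if u * Algebra.norm E t / y ∈ R then
        ψ u * ψ (Algebra.trace E K ((c + t) * a)) else 0 := fun a ↦ by
    have ha := norm_unit_ne_zero (E := E) a
    have key := sum_norm_trace_succ hψ K L hd fun z ↦
      if z / (y * Algebra.norm E (a : K)) ∈ R then ψ (Algebra.trace E K (c * a)) else 0
    have hL : ∀ b : L, (if Algebra.norm E b / Algebra.norm E (a : K) ∈ R then
        ψ (Algebra.trace E K (c * a)) * ψ (Algebra.trace E L (d * b)) else 0) =
        (if Algebra.norm E (d * b) / (y * Algebra.norm E (a : K)) ∈ R then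
          ψ (Algebra.trace E K (c * a)) else 0) * ψ (Algebra.trace E L (d * b)) := fun b ↦ by
      rw [map_mul (Algebra.norm E), Units.val_mk0, mul_div_mul_left _ _ hNd, ite_mul, zero_mul]
    simp_rw [hL]
    have hshift := Equiv.sum_comp (Equiv.mulLeft₀ d hd0) fun b ↦
      (if Algebra.norm E b / (y * Algebra.norm E (a : K)) ∈ R then
          ψ (Algebra.trace E K (c * a)) else 0) * ψ (Algebra.trace E L b)
    simp only [Equiv.mulLeft₀_apply] at hshift
    rw [hshift, key]
    congr 1
    refine Finset.sum_congr rfl fun u _ ↦ ?_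
    rw [← Equiv.sum_comp (Equiv.mulRight₀ (a : K) a.ne_zero)]
    refine Finset.sum_congr rfl fun t _ ↦ ?_
    simp only [Equiv.mulRight₀_apply]
    rw [map_mul (Algebra.norm E), ← mul_assoc u, mul_div_mul_right _ _ ha,
      add_mul, map_add, AddChar.map_add_eq_mul]
    split_ifs
    · ring
    · simp
  have h2 : ∀ t : K, ∑ a : Kˣ, ψ (Algebra.trace E K ((c + t) * a)) =
      (if t = -c then (Fintype.card K : ℂ) else 0) - 1 := fun t ↦ by
    have h := sum_addChar_trace_mul hψ K (c + t)
    rw [sum_eq_add_sum_units, mul_zero, map_zero, AddChar.map_zero_eq_one] at h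
    have hiff : t = -c ↔ c + t = 0 := by rw [eq_neg_iff_add_eq_zero, add_comm]
    simp only [hiff]
    linear_combination h
  -- Summing over a weights each t by |K|·[t = -c] - 1: the constant -1 produces the preceding
  -- double sum, and t = -c a sum over one subgroup.
  have h3 : normSetCharSum ψ R c d = (Fintype.card K - 1 - x * e) -
      Fintype.card K * ∑ u : E, if u * (Algebra.norm E (-c) / y) ∈ R then ψ u else 0 := by
    rw [normSetCharSum]
    simp_rw [h1]
    rw [Finset.sum_neg_distrib, Finset.sum_comm]
    have h4 : ∀ u : E, (∑ a : Kˣ, ∑ t : K, if u * Algebra.norm E t / y ∈ R then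
        ψ u * ψ (Algebra.trace E K ((c + t) * a)) else 0) =
        Fintype.card K * (if u * (Algebra.norm E (-c) / y) ∈ R then ψ u else 0) -
        ∑ t : K, if u * Algebra.norm E t / y ∈ R then ψ u else 0 := fun u ↦ by
      rw [Finset.sum_comm]
      have h5 : ∀ t : K, (∑ a : Kˣ, if u * Algebra.norm E t / y ∈ R then
          ψ u * ψ (Algebra.trace E K ((c + t) * a)) else 0) =
          (if t = -c then (Fintype.card K : ℂ) *
            (if u * Algebra.norm E t / y ∈ R then ψ u else 0) else 0) -
          if u * Algebra.norm E t / y ∈ R then ψ u else 0 := fun t ↦ by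
        split_ifs with h6 h7 h7
        · rw [← Finset.mul_sum, h2, if_pos h7]
          ring
        · rw [← Finset.mul_sum, h2, if_neg h7]
          ring
        · simp
        · simp
      simp_rw [h5]
      rw [Finset.sum_sub_distrib, Finset.sum_ite_eq' Finset.univ (-c), if_pos (Finset.mem_univ _),
        mul_div_assoc]
    simp_rw [h4]
    rw [Finset.sum_sub_distrib, ← Finset.mul_sum, Finset.sum_comm,
      sum_sum_addChar_mul_norm_mem R hR he hψ y]
    ring
  rcases sum_addChar_mul_mem R (ψ := ψ) (div_ne_zero hNc y.ne_zero) with h | h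
  · left
    rw [h3, h, mul_zero, sub_zero]
  · right
    rw [h3, h, hR]
    push_cast
    ring

end

end NormSet

/-- The subtraction x * e - 1 truncates only when x = 0, where the factor x in front kills it. -/
theorem cast_mul_sub_one_add {S : Type*} [CommRing S] (x e' : ℕ) {e c : ℕ} (he : e ≠ 0)
    (hc : 2 ≤ c) : ((x * e' * (x * e - 1) + (c - 2) : ℕ) : S) =
      x * e' * (x * e - 1) + (c - 2) := by
  rw [Nat.cast_add, Nat.cast_sub hc]
  rcases Nat.eq_zero_or_pos x with rfl | hx
  · simp
  · have h : 1 ≤ x * e := Nat.mul_pos hx (Nat.pos_of_ne_zero he)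
    push_cast [Nat.cast_sub h]
    ring

/-! ### The norm set is a partial difference set -/

section NormSetPDS

variable {E : Type*} [Field E] [Fintype E] {K L : Type*} [Field K] [Fintype K] [Algebra E K]
  [Field L] [Fintype L] [Algebra E L] (R : AddSubgroup E)

omit [Fintype E] in
theorem norm_neg_eq (a : K) :
    Algebra.norm E (-a) = (-1) ^ Module.finrank E K * Algebra.norm E a := by
  rw [← neg_one_mul, map_mul, ← map_one (algebraMap E K), ← map_neg, Algebra.norm_algebraMap]

omit [Fintype E] in
-- Negation changes a norm at most by a sign, and R is closed under negation.
theorem neg_mem_normSet (z : K × L) : -z ∈ normSet K L R ↔ z ∈ normSet K L R := by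
  have : FiniteDimensional E K := .of_finite
  have : FiniteDimensional E L := .of_finite
  have h1 : Algebra.norm E (-z).2 / Algebra.norm E (-z).1 =
      (Algebra.norm E z.2 / Algebra.norm E z.1) ∨ Algebra.norm E (-z).2 / Algebra.norm E (-z).1 =
      -(Algebra.norm E z.2 / Algebra.norm E z.1) := by
    rw [Prod.fst_neg, Prod.snd_neg, norm_neg_eq, norm_neg_eq]
    rcases neg_one_pow_eq_or E (Module.finrank E K) with h1 | h1 <;>
    rcases neg_one_pow_eq_or E (Module.finrank E L) with h2 | h2 <;>
    simp [h1, h2, neg_div, div_neg]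
  simp only [normSet, Set.mem_ofPred_eq]
  refine and_congr (by simp) ?_
  rcases h1 with h1 | h1 <;> rw [h1]
  exact R.neg_mem_iff

/-- The character `(a, b) ↦ ψ(Tr(ca) + Tr(db))` of `K × L`. -/
noncomputable def traceChar (ψ : AddChar E ℂ) (i : K × L) : AddChar (K × L) ℂ where
  toFun z := ψ (Algebra.trace E K (i.1 * z.1)) * ψ (Algebra.trace E L (i.2 * z.2))
  map_zero_eq_one' := by simp
  map_add_eq_mul' z w := by
    simp only [Prod.fst_add, Prod.snd_add, mul_add, map_add, AddChar.map_add_eq_mul]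
    ring

omit [Fintype E] in
open Classical in
theorem sum_ite_mem_normSet {M : Type*} [AddCommMonoid M] (f : K × L → M) :
    (∑ z, if z ∈ normSet K L R then f z else 0) = ∑ a : Kˣ, ∑ b : L,
      if Algebra.norm E b / Algebra.norm E (a : K) ∈ R then f (a, b) else 0 := by
  rw [Fintype.sum_prod_type, sum_eq_add_sum_units]
  simp [normSet]

variable {x e e' : ℕ}

theorem isPDS_normSet (hR : Nat.card R = x + 1)
    (he : e * (Fintype.card E - 1) = Fintype.card K - 1)
    (he' : e' * (Fintype.card E - 1) = Fintype.card L - 1)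
    (hd : Module.finrank E L = Module.finrank E K + 1) :
    IsPDS (normSet K L R) (Fintype.card K * Fintype.card L)
      ((Fintype.card K - 1) * (1 + x * e')) (x * e' * (x * e - 1) + (Fintype.card K - 2))
      (x * e * (x * e' + 1)) := by
  classical
  obtain ⟨t, ht⟩ := exists_ne (0 : E)
  obtain ⟨ψ, hψt⟩ := AddChar.exists_apply_ne_zero.2 ht
  have hψ : ψ ≠ 1 := AddChar.ne_one_iff.2 ⟨t, hψt⟩
  have hKpos : 1 < Fintype.card K := Fintype.one_lt_card
  have hLpos : 1 < Fintype.card L := Fintype.one_lt_card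
  have hEpos : 1 < Fintype.card E := Fintype.one_lt_card
  have hLK : Fintype.card L = Fintype.card E * Fintype.card K := by
    rw [Module.card_eq_pow_finrank (K := E) (V := L), hd, pow_succ',
      ← Module.card_eq_pow_finrank (K := E) (V := K)]
  have hsum0 : ∀ (a : K) (b : L), (∑ i : K × L, traceChar ψ i (a, b)) =
      (if a = 0 then (Fintype.card K : ℂ) else 0) * if b = 0 then (Fintype.card L : ℂ) else 0 := by
    intro a b
    rw [← sum_addChar_trace_mul hψ K a, ← sum_addChar_trace_mul hψ L b, Finset.sum_mul_sum,
      Fintype.sum_prod_type]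
    simp only [traceChar, AddChar.coe_mk, mul_comm a, mul_comm b]
  have hsum1 : ∀ (c : K) (d : L), (∑ g : K × L, traceChar ψ (c, d) g) =
      (if c = 0 then (Fintype.card K : ℂ) else 0) * if d = 0 then (Fintype.card L : ℂ) else 0 := by
    intro c d
    rw [← sum_addChar_trace_mul hψ K c, ← sum_addChar_trace_mul hψ L d, Finset.sum_mul_sum,
      Fintype.sum_prod_type]
    rfl
  have hchar : ∀ (c : K) (d : L),
      (∑ g, if g ∈ normSet K L R then traceChar ψ (c, d) g else 0) =
        normSetCharSum ψ R c d := fun c d ↦ by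
    rw [sum_ite_mem_normSet, normSetCharSum]
    rfl
  have h00 : normSetCharSum ψ R (0 : K) (0 : L) = (1 + e' * x) * (Fintype.card K - 1) := by
    rw [normSetCharSum_right_zero R hR he']
    simp [Fintype.card_units, Nat.cast_sub hKpos.le]
  have he0 : e ≠ 0 := by
    rintro rfl
    omega
  have hlam := cast_mul_sub_one_add (S := ℂ) x e' he0 hKpos
  have heC : (e : ℂ) * (Fintype.card E - 1) = Fintype.card K - 1 := by
    have := congrArg (Nat.cast : ℕ → ℂ) he
    push_cast [Nat.cast_sub hEpos.le, Nat.cast_sub hKpos.le] at this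
    exact this
  -- This merges the values: A - 1 - xe - A(x + 1) equals -(1 + xe') with A = |K|, so only two
  -- nontrivial sums remain.
  have heC' : (e' : ℂ) = e + Fintype.card K := by
    have h1 : e' * (Fintype.card E - 1) = (e + Fintype.card K) * (Fintype.card E - 1) := by
      rw [he', add_mul, he, hLK, Nat.mul_sub, mul_one, mul_comm]
      have := Nat.le_mul_of_pos_right (Fintype.card K) (show 0 < Fintype.card E by omega)
      omega
    exact_mod_cast Nat.eq_of_mul_eq_mul_right (Nat.sub_pos_of_lt hEpos) h1
  rw [← Fintype.card_prod]
  refine isPDS_of_sum_addChar (traceChar ψ) ?_ ?_ (neg_mem_normSet R) ?_ ?_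
  · rintro ⟨a, b⟩ hab
    rw [hsum0]
    by_cases ha : a = 0
    · have hb : b ≠ 0 := fun hb ↦ hab (by rw [ha, hb]; rfl)
      rw [if_neg hb, mul_zero]
    · rw [if_neg ha, zero_mul]
  · exact fun h ↦ h.1 rfl
  · have h1 : ((normSet K L R).ncard : ℂ) = normSetCharSum ψ R (0 : K) (0 : L) := by
      rw [← hchar, Set.ncard_eq_toFinset_card', Set.toFinset_card, Fintype.card_subtype,
        ← Finset.sum_boole]
      simp [traceChar]
    rw [h00] at h1
    have h2 : (((Fintype.card K - 1) * (1 + x * e') : ℕ) : ℂ) =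
        (1 + e' * x) * (Fintype.card K - 1) := by
      push_cast [Nat.cast_sub hKpos.le]
      ring
    rw [← h2] at h1
    exact_mod_cast h1
  · rintro ⟨c, d⟩
    rw [hchar, hsum1, hlam]
    push_cast [Nat.cast_sub hKpos.le]
    have hLC : (Fintype.card L : ℂ) = Fintype.card E * Fintype.card K := by exact_mod_cast hLK
    have h0d := fun (d : L) (hd0 : d ≠ 0) ↦ normSetCharSum_left_zero (K := K) R hR he hψ hd0
    have hc0 : ∀ c : K, c ≠ 0 → normSetCharSum ψ R c (0 : L) = -(1 + e' * x) := fun c hc ↦ by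
      rw [normSetCharSum_right_zero R hR he', sum_units_addChar_trace_mul hψ K hc]
      ring
    have hcd := fun (c : K) (d : L) (hc : c ≠ 0) (hd0 : d ≠ 0) ↦
      normSetCharSum_of_ne_zero R hR he hψ hd hc hd0
    rw [heC'] at h00 hc0 ⊢
    generalize (Fintype.card K : ℂ) = A at *
    generalize (Fintype.card E : ℂ) = Q at *
    by_cases hc : c = 0 <;> by_cases hd0 : d = 0
    · subst hc hd0
      simp only [if_true]
      rw [h00]
      -- For the trivial character the equation is the count k² = k + λk + μ(v - 1 - k), the only
      -- case that uses the relation between |K|, |E| and e.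
      obtain rfl : A = 1 + e * (Q - 1) := by linear_combination -heC
      rw [hLC]
      ring
    · subst hc
      rw [h0d d hd0, if_neg hd0]
      ring
    · subst hd0
      rw [hc0 c hc, if_neg hc]
      ring
    · rw [if_neg hc, if_neg hd0]
      rcases hcd c d hc hd0 with h | h <;> rw [h] <;> ring

end NormSetPDS

/-! ### From partial difference sets to strongly regular graphs -/

section CayleyGraphs

variable {G H : Type*} [AddCommGroup G] [AddCommGroup H] {D : Set G} {v k lam mu : ℕ}

theorem addCayley_adj_iff_sub_mem (h0 : (0 : G) ∉ D) (hneg : ∀ g : G, -g ∈ D ↔ g ∈ D) (g h : G) :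
    (SimpleGraph.addCayley D).Adj g h ↔ g - h ∈ D := by
  rw [SimpleGraph.addCayley_adj, neg_add_eq_sub, neg_add_eq_sub, ← hneg (h - g), neg_sub, or_self]
  refine ⟨fun h ↦ h.2, fun h' ↦ ⟨?_, h'⟩⟩
  rintro rfl
  exact h0 (by rwa [sub_self] at h')

/-- The Cayley graph of a symmetric partial difference set is strongly regular. -/
theorem IsPDS.isCayleySRG [Fintype G] (h : IsPDS D v k lam mu) (hneg : ∀ g : G, -g ∈ D ↔ g ∈ D)
    (hne : D.Nonempty) (htop : ∃ g : G, g ≠ 0 ∧ g ∉ D) : IsCayleySRG D v k lam mu := by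
  have hadj := addCayley_adj_iff_sub_mem h.zero_notMem hneg
  have hcommon : ∀ u w : G, u ≠ w →
      ((SimpleGraph.addCayley D).commonNeighbors u w).ncard =
      {z : G × G | z.1 ∈ D ∧ z.2 ∈ D ∧ z.1 ≠ z.2 ∧ z.1 - z.2 = u - w}.ncard := by
    intro u w huw
    have himage : {z : G × G | z.1 ∈ D ∧ z.2 ∈ D ∧ z.1 ≠ z.2 ∧ z.1 - z.2 = u - w} =
        (fun x ↦ (u - x, w - x)) '' (SimpleGraph.addCayley D).commonNeighbors u w := by
      ext ⟨a, b⟩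
      simp only [Set.mem_ofPred_eq, Set.mem_image, SimpleGraph.mem_commonNeighbors, hadj,
        Prod.mk.injEq]
      constructor
      · rintro ⟨ha, hb, -, hab⟩
        have hb' : w - (u - a) = b := by
          rw [← sub_eq_zero, ← sub_eq_zero.2 hab]
          abel
        exact ⟨u - a, ⟨by rwa [sub_sub_cancel], by rwa [hb']⟩, sub_sub_cancel _ _, hb'⟩
      · rintro ⟨x, ⟨h1, h2⟩, rfl, rfl⟩
        refine ⟨h1, h2, fun h ↦ huw (sub_left_injective h), sub_sub_sub_cancel_right _ _ _⟩
    rw [himage, Set.ncard_image_of_injective _ fun a b hab ↦ by simpa using congrArg Prod.fst hab]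
  have hsrg : ∀ _ : DecidableRel (SimpleGraph.addCayley D).Adj,
      (SimpleGraph.addCayley D).IsSRGWith v k lam mu := by
    intro _
    refine ⟨?_, ?_, ?_, ?_⟩
    · rw [← Nat.card_eq_fintype_card, h.card_group]
    · intro u
      rw [← SimpleGraph.card_neighborSet_eq_degree, ← Nat.card_eq_fintype_card,
        Nat.card_coe_set_eq, ← h.card_set]
      have : (SimpleGraph.addCayley D).neighborSet u = (fun g ↦ u - g) '' D := by
        ext w
        simp only [SimpleGraph.mem_neighborSet, hadj, Set.mem_image]
        refine ⟨fun hw ↦ ⟨_, hw, sub_sub_cancel _ _⟩, ?_⟩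
        rintro ⟨g, hg, rfl⟩
        rwa [sub_sub_cancel]
      rw [this, Set.ncard_image_of_injective _ sub_right_injective]
    · intro u w huw
      rw [← h.of_mem _ ((hadj u w).1 huw), ← hcommon u w huw.ne, ← Nat.card_eq_fintype_card,
        Nat.card_coe_set_eq]
    · intro u w huw hn
      rw [← h.of_notMem _ (sub_ne_zero.2 huw) (mt (hadj u w).2 hn), ← hcommon u w huw,
        ← Nat.card_eq_fintype_card, Nat.card_coe_set_eq]
  refine ⟨h.zero_notMem, hneg, ⟨hsrg _, ?_, ?_⟩⟩
  · intro ht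
    obtain ⟨g, hg, hgD⟩ := htop
    refine hgD ?_
    have : (SimpleGraph.addCayley D).Adj g 0 := by
      rw [ht]
      exact hg
    simpa using (hadj g 0).1 this
  · intro hb
    obtain ⟨g, hg⟩ := hne
    have : (SimpleGraph.addCayley D).Adj g 0 := (hadj g 0).2 (by simpa using hg)
    rw [hb] at this
    exact this

theorem IsPDS.map [Finite G] [Finite H] (h : IsPDS D v k lam mu) (f : G ≃+ H) :
    IsPDS (f '' D) v k lam mu := by
  have hmem : ∀ g, f g ∈ f '' D ↔ g ∈ D := fun g ↦ f.injective.mem_set_image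
  have hcount : ∀ x, {z : H × H | z.1 ∈ f '' D ∧ z.2 ∈ f '' D ∧ z.1 ≠ z.2 ∧
      z.1 - z.2 = f x}.ncard =
      {z : G × G | z.1 ∈ D ∧ z.2 ∈ D ∧ z.1 ≠ z.2 ∧ z.1 - z.2 = x}.ncard := by
    intro x
    rw [← Set.ncard_image_of_injective _ (f.injective.prodMap f.injective)]
    congr 1
    ext ⟨a, b⟩
    obtain ⟨a, rfl⟩ := f.surjective a
    obtain ⟨b, rfl⟩ := f.surjective b
    rw [show (f a, f b) = Prod.map f f (a, b) from rfl,
      (f.injective.prodMap f.injective).mem_set_image]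
    simp only [Set.mem_ofPred_eq, Prod.map_fst, Prod.map_snd, hmem, ne_eq, f.injective.eq_iff,
      ← map_sub]
  refine ⟨(Nat.card_congr f.toEquiv).symm.trans h.card_group, ?_, ?_, ?_, ?_⟩
  · rw [Set.ncard_image_of_injective _ f.injective, h.card_set]
  · rw [← map_zero f, hmem]
    exact h.zero_notMem
  · intro x hx
    obtain ⟨x, rfl⟩ := f.surjective x
    rw [hcount, h.of_mem x ((hmem x).1 hx)]
  · intro x hx hxD
    obtain ⟨x, rfl⟩ := f.surjective x
    rw [hcount, h.of_notMem x (fun h0 ↦ hx (by rw [h0, map_zero])) (mt (hmem x).2 hxD)]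

end CayleyGraphs

/-! ### The maximum clique -/

section NormSetGraph

variable {E : Type*} [Field E] {K L : Type*} [Field K] [Fintype K] [Algebra E K]
  [Field L] [Fintype L] [Algebra E L] (R : AddSubgroup E)

omit [Fintype K] in
theorem mk_zero_mem_normSet (a : K) : (a, (0 : L)) ∈ normSet K L R ↔ a ≠ 0 := by
  have : FiniteDimensional E L := .of_finite
  simp [normSet, R.zero_mem]

omit [Fintype K] [Fintype L] in
theorem zero_mk_notMem_normSet (b : L) : ((0 : K), b) ∉ normSet K L R := fun h ↦ h.1 rfl

/-- No element of the connection set has first coordinate 0, so the projection to K is injective on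
every clique and |K| bounds its size. -/
theorem isMaximumClique_normSet :
    (SimpleGraph.addCayley (normSet K L R)).IsMaximumClique
      (Finset.univ ×ˢ {0} : Finset (K × L)) := by
  have hadj := addCayley_adj_iff_sub_mem (zero_mk_notMem_normSet (K := K) (L := L) R 0)
    (neg_mem_normSet R)
  rw [SimpleGraph.isMaximumClique_iff]
  constructor
  · rintro ⟨a, b⟩ hab ⟨a', b'⟩ hab' hne
    simp only [Finset.coe_product, Finset.coe_univ, Finset.coe_singleton, Set.mem_prod,
      Set.mem_univ, Set.mem_singleton_iff, true_and] at hab hab'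
    subst hab hab'
    rw [hadj, Prod.mk_sub_mk, sub_zero, mk_zero_mem_normSet]
    exact sub_ne_zero.2 fun h ↦ hne (by rw [h])
  · intro t ht
    rw [Finset.card_product, Finset.card_singleton, mul_one]
    refine Finset.card_le_card_of_injOn Prod.fst (fun _ _ ↦ Finset.mem_univ _) ?_
    rintro ⟨a, b⟩ hab ⟨a', b'⟩ hab' h
    by_contra hne
    have := (hadj _ _).1 (ht hab hab' hne)
    rw [Prod.mk_sub_mk, sub_eq_zero.2 h] at this
    exact zero_mk_notMem_normSet R _ this

end NormSetGraph

/-! ### Cyclotomic classes as congruences of exponents -/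

section Cyclotomy

variable {F E : Type*} [Field F] [Field E] [Algebra F E]

/-- Membership in a cyclotomic class is a congruence of exponents. -/
theorem zpow_mem_cyclotomicClass {ω : Eˣ} {e i : ℕ} (he : e ∣ orderOf ω) (j : ℤ) :
    ((ω ^ j : Eˣ) : E) ∈ cyclotomicClass ω e i ↔ j ≡ i [ZMOD e] := by
  simp only [cyclotomicClass, Set.mem_ofPred_eq, Subgroup.mem_zpowers_iff]
  constructor
  · rintro ⟨_, ⟨n, rfl⟩, h⟩
    rw [Units.val_inj, ← zpow_natCast, ← zpow_natCast, ← zpow_mul, ← zpow_add,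
      zpow_eq_zpow_iff_modEq] at h
    exact (h.of_dvd (Int.natCast_dvd_natCast.2 he)).trans (by simp [Int.modEq_iff_dvd])
  · intro h
    obtain ⟨n, hn⟩ := h.symm.dvd
    refine ⟨_, ⟨n, rfl⟩, ?_⟩
    rw [Units.val_inj, ← zpow_natCast, ← zpow_natCast, ← zpow_mul, ← zpow_add, ← hn,
      add_sub_cancel]

/-- A root of unity of order dividing `|F| - 1` lies in the finite field `F`. -/
theorem exists_algebraMap_eq_of_pow_card_eq [Finite F] {z : E} (hz : z ^ Nat.card F = z) :
    ∃ c : F, algebraMap F E c = z := by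
  have h0 : (Polynomial.X ^ Nat.card F - Polynomial.X : Polynomial F) ≠ 0 :=
    FiniteField.X_pow_card_sub_X_ne_zero F Finite.one_lt_card
  refine Polynomial.splits_X_pow_nat_card_sub_X.mem_range_of_isRoot h0 (i := algebraMap F E) ?_
  simp [hz]

/-- Since γ^e is fixed by the |F|-th power map, it is a nonzero scalar of F. Hence membership of γ^j
in the subspace R depends only on j modulo e. -/
theorem zpow_mem_iff_exists_exponentSet [Finite F] (R : Submodule F E) {γ : Eˣ} {e : ℕ}
    (he0 : e ≠ 0) (he : e * (Nat.card F - 1) = orderOf γ) (j : ℤ) :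
    ((γ ^ j : Eˣ) : E) ∈ R ↔ ∃ t ∈ exponentSet R γ e, j ≡ t [ZMOD e] := by
  obtain ⟨c, hc⟩ : ∃ c : F, algebraMap F E c = (γ : E) ^ e := by
    refine exists_algebraMap_eq_of_pow_card_eq ?_
    have h1 : Nat.card F = Nat.card F - 1 + 1 := (Nat.sub_add_cancel Nat.card_pos).symm
    rw [h1, pow_succ, ← pow_mul, he, ← Units.val_pow_eq_pow_val γ (orderOf γ), pow_orderOf_eq_one,
      Units.val_one, one_mul]
  have hc0 : c ≠ 0 := by
    rintro rfl
    rw [map_zero] at hc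
    exact pow_ne_zero e γ.ne_zero hc.symm
  have hmod : ∀ (i : ℤ) (n : ℤ), ((γ ^ (i + e * n) : Eˣ) : E) ∈ R ↔ ((γ ^ i : Eˣ) : E) ∈ R := by
    intro i n
    have : ((γ ^ (i + e * n) : Eˣ) : E) = c ^ n • ((γ ^ i : Eˣ) : E) := by
      rw [zpow_add, Units.val_mul, zpow_mul, zpow_natCast, Units.val_zpow_eq_zpow_val (γ ^ e),
        Units.val_pow_eq_pow_val, ← hc, ← map_zpow₀, Algebra.smul_def, mul_comm]
    rw [this, R.smul_mem_iff (zpow_ne_zero n hc0)]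
  have heZ : (0 : ℤ) < e := by exact_mod_cast Nat.pos_of_ne_zero he0
  constructor
  · intro h
    have h1 : ((j % e).toNat : ℤ) = j % e := Int.toNat_of_nonneg (Int.emod_nonneg _ heZ.ne')
    refine ⟨(j % e).toNat, ⟨?_, ?_⟩, ?_⟩
    · have := Int.emod_lt_of_pos j heZ
      omega
    · rw [← Units.val_pow_eq_pow_val, ← zpow_natCast, h1, ← hmod _ (j / e), Int.emod_add_mul_ediv]
      exact h
    · rw [h1]
      exact (Int.mod_modEq j e).symm
  · rintro ⟨t, ⟨-, ht⟩, h⟩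
    obtain ⟨n, hn⟩ := h.symm.dvd
    rw [← Units.val_pow_eq_pow_val, ← zpow_natCast, ← hmod _ n, ← hn, add_sub_cancel] at ht
    exact ht

theorem exists_zpow_eq {ω : Eˣ} (hω : IsPrimitiveElt ω) {a : E} (ha : a ≠ 0) :
    ∃ j : ℤ, ((ω ^ j : Eˣ) : E) = a := by
  obtain ⟨j, hj⟩ := Subgroup.mem_zpowers_iff.1 (hω (Units.mk0 a ha))
  exact ⟨j, by rw [hj, Units.val_mk0]⟩

theorem orderOf_eq_of_isPrimitiveElt {ω : Eˣ} (hω : IsPrimitiveElt ω) :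
    orderOf ω = Nat.card E - 1 := by
  rw [orderOf_eq_card_of_forall_mem_zpowers hω, Nat.card_units]

variable {K L : Type*} [Field K] [Field L]

theorem mem_dennistonSet {α : Kˣ} {β : Lˣ} {e : ℕ} (he0 : e ≠ 0) (hα : e ∣ orderOf α)
    (hβ : e ∣ orderOf β) (T : Set ℕ) (j k : ℤ) :
    (((α ^ j : Kˣ) : K), ((β ^ k : Lˣ) : L)) ∈ dennistonSet α β e T ↔
      ∃ t ∈ T, k - j ≡ t [ZMOD e] := by
  simp only [dennistonSet, Set.mem_union, Set.mem_iUnion, Set.mem_prod, Set.mem_singleton_iff,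
    Units.ne_zero, and_false, or_false, Finset.mem_range, zpow_mem_cyclotomicClass hα,
    zpow_mem_cyclotomicClass hβ, exists_prop]
  constructor
  · rintro ⟨i, -, hi, t, ht, hk⟩
    refine ⟨t, ht, ?_⟩
    have := hk.sub hi
    rwa [Nat.cast_add, add_sub_cancel_left] at this
  · rintro ⟨t, ht, h⟩
    have heZ : (0 : ℤ) < e := by exact_mod_cast Nat.pos_of_ne_zero he0
    have h1 : ((j % e).toNat : ℤ) = j % e := Int.toNat_of_nonneg (Int.emod_nonneg _ heZ.ne')
    have h2 : j ≡ (j % e).toNat [ZMOD e] := by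
      rw [h1]
      exact (Int.mod_modEq j e).symm
    refine ⟨(j % e).toNat, ?_, h2, t, ht, ?_⟩
    · have := Int.emod_lt_of_pos j heZ
      omega
    · have := h2.add h
      rwa [add_sub_cancel, ← Nat.cast_add] at this

theorem mk_zero_mem_dennistonSet {α : Kˣ} {β : Lˣ} {e : ℕ} (T : Set ℕ) (a : K) :
    (a, (0 : L)) ∈ dennistonSet α β e T ↔ a ≠ 0 := by
  have h : ∀ i, (0 : L) ∉ cyclotomicClass β e i := by
    rintro i ⟨u, -, hu⟩
    exact (β ^ i * u).ne_zero hu.symm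
  simp [dennistonSet, h]

theorem zero_mk_notMem_dennistonSet {α : Kˣ} {β : Lˣ} {e : ℕ} (T : Set ℕ) (b : L) :
    ((0 : K), b) ∉ dennistonSet α β e T := by
  have h : ∀ i, (0 : K) ∉ cyclotomicClass α e i := by
    rintro i ⟨u, -, hu⟩
    exact (α ^ i * u).ne_zero hu.symm
  simp [dennistonSet, h]

variable [Algebra E K] [Algebra E L] [Finite L]

omit [Finite L] [Algebra E L] in
theorem norm_zpow_eq {α : Kˣ} {γ : Eˣ} (h : Algebra.norm E (α : K) = γ) (j : ℤ) :
    Algebra.norm E ((α ^ j : Kˣ) : K) = ((γ ^ j : Eˣ) : E) := by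
  have : Units.map (Algebra.norm E) α = γ := Units.ext h
  rw [← this, ← map_zpow]
  rfl

omit [Finite L] [Algebra E L] in
theorem dvd_orderOf_of_norm_eq {α : Kˣ} {γ : Eˣ} (h : Algebra.norm E (α : K) = γ) {e : ℕ}
    (he : e ∣ orderOf γ) : e ∣ orderOf α := by
  have : Units.map (Algebra.norm E) α = γ := Units.ext h
  rw [← this] at he
  exact he.trans (orderOf_map_dvd _ _)

variable [Finite F] (R : Submodule F E) {α : Kˣ} {β : Lˣ} {γ : Eˣ} (hα : IsPrimitiveElt α)
  (hβ : IsPrimitiveElt β) (hNα : Algebra.norm E (α : K) = γ) (hNβ : Algebra.norm E (β : L) = γ)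
  {e : ℕ} (he0 : e ≠ 0) (he : e * (Nat.card F - 1) = orderOf γ)

include hα hβ hNα hNβ he0 he

/-- For a = α^j and b = β^k the common norm γ gives N(b)/N(a) = γ^(k-j), so both memberships say
that k - j is congruent modulo e to an element of T. -/
theorem dennistonSet_eq_normSet :
    dennistonSet α β e (exponentSet R γ e) = normSet K L R.toAddSubgroup := by
  have : FiniteDimensional E L := .of_finite
  have := Fintype.ofFinite L
  ext ⟨a, b⟩
  rcases eq_or_ne a 0 with rfl | ha
  · exact iff_of_false (zero_mk_notMem_dennistonSet _ _) (zero_mk_notMem_normSet _ _)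
  rcases eq_or_ne b 0 with rfl | hb
  · rw [mk_zero_mem_dennistonSet, mk_zero_mem_normSet]
  obtain ⟨j, rfl⟩ := exists_zpow_eq hα ha
  obtain ⟨k, rfl⟩ := exists_zpow_eq hβ hb
  rw [mem_dennistonSet he0 (dvd_orderOf_of_norm_eq hNα (Dvd.intro _ he))
      (dvd_orderOf_of_norm_eq hNβ (Dvd.intro _ he)),
    ← zpow_mem_iff_exists_exponentSet R he0 he, zpow_sub, ← div_eq_mul_inv]
  simp only [normSet, Set.mem_ofPred_eq, ne_eq, Units.ne_zero, not_false_eq_true, true_and,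
    norm_zpow_eq hNα, norm_zpow_eq hNβ, ← Units.val_div_eq_div_val]
  rfl

end Cyclotomy

/-! ### The two norm descriptions -/

section NormSetUnion

variable {F E : Type*} [Field F] [Field E] [Algebra F E] {K L : Type*} [Field K] [Field L]
  [Algebra E K] [Algebra E L] [Finite K] [Finite L]

theorem normSet_eq_union (R : AddSubgroup E) :
    normSet K L R = {z : K × L | z.1 ≠ 0 ∧ z.2 ≠ 0 ∧
        Algebra.norm E z.2 / Algebra.norm E z.1 ∈ (R : Set E) \ {0}} ∪
      {z : K × L | z.1 ≠ 0 ∧ z.2 = 0} := by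
  have : FiniteDimensional E K := .of_finite
  have : FiniteDimensional E L := .of_finite
  ext ⟨a, b⟩
  rcases eq_or_ne b 0 with rfl | hb
  · simp [normSet, R.zero_mem]
  · simp only [normSet, Set.mem_ofPred_eq, Set.mem_union, ne_eq, hb, not_false_eq_true, true_and,
      and_false, or_false, Set.mem_sdiff, SetLike.mem_coe, Set.mem_singleton_iff]
    refine and_congr_right fun ha ↦ ?_
    rw [div_eq_zero_iff, Algebra.norm_eq_zero_iff, Algebra.norm_eq_zero_iff]
    simp [ha, hb]

theorem iUnion_cyclotomicClass_eq [Finite F] (R : Submodule F E) {γ : Eˣ}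
    (hγ : IsPrimitiveElt γ) {e : ℕ} (he0 : e ≠ 0) (he : e * (Nat.card F - 1) = orderOf γ) :
    ⋃ t ∈ exponentSet R γ e, cyclotomicClass γ e t = (R : Set E) \ {0} := by
  ext z
  rcases eq_or_ne z 0 with rfl | hz
  · have h : ∀ i, (0 : E) ∉ cyclotomicClass γ e i := by
      rintro i ⟨u, -, hu⟩
      exact (γ ^ i * u).ne_zero hu.symm
    simp [h]
  · obtain ⟨j, rfl⟩ := exists_zpow_eq hγ hz
    simp only [Set.mem_iUnion, zpow_mem_cyclotomicClass (Dvd.intro _ he), exists_prop,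
      ← zpow_mem_iff_exists_exponentSet R he0 he, Set.mem_sdiff, SetLike.mem_coe,
      Set.mem_singleton_iff, Units.ne_zero, not_false_eq_true, and_true]

end NormSetUnion

/-! ### Existence of compatible primitive elements -/

section PrimitiveElements

/-- Generators lift along surjections of finite cyclic groups. -/
theorem exists_generator_map_eq {G H : Type*} [Group G] [Finite G] [IsCyclic G] [Group H]
    (f : G →* H) (hf : Function.Surjective f) {γ : H} (hγ : ∀ x, x ∈ Subgroup.zpowers γ) :
    ∃ α : G, (∀ x, x ∈ Subgroup.zpowers α) ∧ f α = γ := by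
  obtain ⟨g, hg⟩ := IsCyclic.exists_generator (α := G)
  have : Finite H := Finite.of_surjective f hf
  have hfg : ∀ x, x ∈ Subgroup.zpowers (f g) := fun x ↦ by
    obtain ⟨y, rfl⟩ := hf x
    obtain ⟨n, rfl⟩ := hg y
    exact ⟨n, (map_zpow f g n).symm⟩
  obtain ⟨j, rfl⟩ := (isOfFinOrder_of_finite (f g)).mem_powers_iff_mem_zpowers.2 (hfg γ)
  have hdvd : orderOf (f g) ∣ orderOf g := orderOf_map_dvd f g
  have : NeZero (orderOf g) := ⟨(orderOf_pos g).ne'⟩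
  have hcop : j.Coprime (orderOf (f g)) := by
    have h1 := orderOf_eq_card_of_forall_mem_zpowers hγ
    have h2 := orderOf_eq_card_of_forall_mem_zpowers hfg
    have h3 : orderOf (f g ^ j) = orderOf (f g) := h1.trans h2.symm
    rw [orderOf_pow, Nat.div_eq_self] at h3
    exact Nat.Coprime.symm (h3.resolve_left (orderOf_pos _).ne')
  -- The exponent j is coprime only to the order of f g; lifting its residue to a unit modulo the
  -- order of g makes the power of g a generator without changing its image.
  obtain ⟨u, hu⟩ := ZMod.unitsMap_surjective hdvd (ZMod.unitOfCoprime j hcop)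
  refine ⟨g ^ (u : ZMod (orderOf g)).val, ?_, ?_⟩
  · obtain ⟨n, hn⟩ := exists_pow_eq_self_of_coprime (ZMod.val_coe_unit_coprime u)
    intro x
    have : g ∈ Subgroup.zpowers (g ^ (u : ZMod (orderOf g)).val) := ⟨n, by simpa using hn⟩
    exact (Subgroup.zpowers_le.2 this) (hg x)
  · rw [map_pow, pow_eq_pow_iff_modEq, ← ZMod.natCast_eq_natCast_iff]
    have := congrArg Units.val hu
    simpa [ZMod.unitsMap_val] using this

theorem exists_isPrimitiveElt_norm_eq {E : Type*} [Field E] (K : Type*) [Field K] [Finite K]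
    [Algebra E K] {γ : Eˣ} (hγ : IsPrimitiveElt γ) :
    ∃ α : Kˣ, IsPrimitiveElt α ∧ Algebra.norm E (α : K) = γ := by
  have : Finite E := Finite.of_injective _ (algebraMap E K).injective
  obtain ⟨α, hα, h⟩ := exists_generator_map_eq (Units.map (Algebra.norm E))
    (FiniteField.unitsMap_norm_surjective E K) hγ
  exact ⟨α, hα, congrArg Units.val h⟩

end PrimitiveElements

/-! ### Parameters and the elementary abelian model -/

section Parameters

/-- The generalized Denniston partial difference sets, from an additive subgroup of a finite field. -/
theorem exists_params_isPDS_normSet {E K L : Type*} [Field E] [Fintype E] [Field K] [Fintype K]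
    [Algebra E K] [Field L] [Fintype L] [Algebra E L] {q m l r : ℕ} (hq : 2 ≤ q)
    (hE : Fintype.card E = q ^ m) (hK : Module.finrank E K = l)
    (hL : Module.finrank E L = l + 1) (R : AddSubgroup E) (hR : Nat.card R = q ^ r) :
    ∃ v k lam mu : ℕ, IsGenDennistonParams q m l r v k lam mu ∧
      IsPDS (normSet K L R) v k lam mu ∧ IsCayleySRG (normSet K L R) v k lam mu := by
  have hKc : Fintype.card K = q ^ (m * l) := by
    rw [Module.card_eq_pow_finrank (K := E) (V := K), hE, hK, pow_mul]
  have hLc : Fintype.card L = q ^ (m * (l + 1)) := by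
    rw [Module.card_eq_pow_finrank (K := E) (V := L), hE, hL, pow_mul]
  have hdiv : ∀ n, ∃ e, e * (q ^ m - 1) = q ^ (m * n) - 1 := fun n ↦ by
    obtain ⟨e, he⟩ := Nat.sub_dvd_pow_sub_pow (q ^ m) 1 n
    exact ⟨e, by rw [mul_comm, ← he, one_pow, pow_mul]⟩
  obtain ⟨e, he⟩ := hdiv l
  obtain ⟨e', he'⟩ := hdiv (l + 1)
  obtain ⟨x, hx⟩ : ∃ x, q ^ r = x + 1 :=
    ⟨q ^ r - 1, (Nat.sub_add_cancel (Nat.pow_pos (by omega))).symm⟩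
  have hK1 : 2 ≤ q ^ (m * l) := hKc ▸ Fintype.one_lt_card
  have hL1 : 2 ≤ q ^ (m * (l + 1)) := hLc ▸ Fintype.one_lt_card
  have hE1 : 2 ≤ q ^ m := hE ▸ Fintype.one_lt_card
  have hpds := isPDS_normSet (K := K) (L := L) R (hR.trans hx) (e := e) (e' := e')
    (by rw [hE, hKc, he]) (by rw [hE, hLc, he']) (by rw [hK, hL])
  rw [hKc, hLc] at hpds
  have hv : q ^ (m * l) * q ^ (m * (l + 1)) = q ^ (m * (2 * l + 1)) := by
    rw [← pow_add]
    congr 1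
    ring
  rw [hv] at hpds
  refine ⟨_, _, _, _, ⟨rfl, ?_, ?_, ?_⟩, hpds, hpds.isCayleySRG (neg_mem_normSet R)
    ⟨(1, 0), (mk_zero_mem_normSet R 1).2 one_ne_zero⟩
    ⟨(0, 1), by simp, zero_mk_notMem_normSet R 1⟩⟩
  all_goals
    have he0 : e ≠ 0 := by
      rintro rfl
      omega
    have hxQ : (q : ℚ) ^ r = x + 1 := by exact_mod_cast hx
    have heQ : (e : ℚ) * ((q : ℚ) ^ m - 1) = (q : ℚ) ^ (m * l) - 1 := by
      have := congrArg (Nat.cast : ℕ → ℚ) he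
      push_cast [Nat.cast_sub (show 1 ≤ q ^ m by omega),
        Nat.cast_sub (show 1 ≤ q ^ (m * l) by omega)] at this
      exact this
    have heQ' : (e' : ℚ) * ((q : ℚ) ^ m - 1) = (q : ℚ) ^ (m * (l + 1)) - 1 := by
      have := congrArg (Nat.cast : ℕ → ℚ) he'
      push_cast [Nat.cast_sub (show 1 ≤ q ^ m by omega),
        Nat.cast_sub (show 1 ≤ q ^ (m * (l + 1)) by omega)] at this
      exact this
    have hne : (q : ℚ) ^ m - 1 ≠ 0 := by
      have : (2 : ℚ) ≤ (q : ℚ) ^ m := by exact_mod_cast hE1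
      linarith
    have h1 : (((q : ℚ) ^ r - 1) * ((q : ℚ) ^ (m * l) - 1)) / ((q : ℚ) ^ m - 1) = x * e := by
      rw [← heQ, hxQ, div_eq_iff hne]
      ring
    have h2 : (((q : ℚ) ^ r - 1) * ((q : ℚ) ^ (m * (l + 1)) - 1)) / ((q : ℚ) ^ m - 1) =
        x * e' := by
      rw [← heQ', hxQ, div_eq_iff hne]
      ring
  · push_cast [Nat.cast_sub (show 1 ≤ q ^ (m * l) by omega)]
    rw [mul_right_comm, mul_div_right_comm, h2]
    ring
  · rw [h1, h2, cast_mul_sub_one_add _ _ he0 hK1]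
    push_cast
    ring
  · rw [h1, h2]
    push_cast
    ring

/-- A finite abelian group of exponent `p` and order `p ^ n` is isomorphic to `(ℤ/p)^n`. -/
theorem nonempty_addEquiv_zmod_pi {V : Type*} [AddCommGroup V] {p n : ℕ} [Fact p.Prime]
    (hp : ∀ x : V, p • x = 0) (hV : Nat.card V = p ^ n) : Nonempty (V ≃+ (Fin n → ZMod p)) := by
  have hpos := (Fact.out : p.Prime).pos
  have : Finite V := Nat.finite_of_card_ne_zero (hV ▸ (pow_pos hpos n).ne')
  have : Module (ZMod p) V := AddCommGroup.zmodModule hp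
  have : Module.Finite (ZMod p) V := .of_finite
  have h : Module.finrank (ZMod p) V = n :=
    Nat.pow_right_injective (Fact.out : p.Prime).two_le
      ((FiniteField.pow_finrank_eq_natCard p V).trans hV)
  obtain ⟨f⟩ : Nonempty (V ≃ₗ[ZMod p] (Fin n → ZMod p)) :=
    FiniteDimensional.nonempty_linearEquiv_of_finrank_eq
      (h.trans (Module.finrank_fin_fun (ZMod p)).symm)
  exact ⟨f.toAddEquiv⟩

theorem nonempty_prod_addEquiv_zmod_pi {E K L : Type*} [Field E] [Fintype E] [Field K] [Finite K]
    [Algebra E K] [Field L] [Finite L] [Algebra E L] {p s m l : ℕ} [Fact p.Prime] [CharP E p]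
    (hE : Fintype.card E = p ^ (s * m)) (hK : Module.finrank E K = l)
    (hL : Module.finrank E L = l + 1) :
    Nonempty (K × L ≃+ (Fin (s * m * (2 * l + 1)) → ZMod p)) := by
  apply nonempty_addEquiv_zmod_pi
  · rintro ⟨a, b⟩
    have h1 : (p : K) = 0 := by rw [← map_natCast (algebraMap E K), CharP.cast_eq_zero, map_zero]
    have h2 : (p : L) = 0 := by rw [← map_natCast (algebraMap E L), CharP.cast_eq_zero, map_zero]
    rw [Prod.smul_mk, nsmul_eq_mul, nsmul_eq_mul, h1, h2, zero_mul, zero_mul]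
    rfl
  · rw [Nat.card_prod, Module.natCard_eq_pow_finrank (K := E) (V := K),
      Module.natCard_eq_pow_finrank (K := E) (V := L), hK, hL, Nat.card_eq_fintype_card, hE,
      ← pow_add, ← pow_mul]
    congr 1
    ring

theorem exists_pds_zmod_pi {p s q m l r : ℕ} [Fact p.Prime] (hs : 1 ≤ s) (hq : q = p ^ s)
    (hm : 1 ≤ m) (hl : 1 ≤ l) (hr : r ≤ m) :
    ∃ v k lam mu : ℕ, IsGenDennistonParams q m l r v k lam mu ∧
      ∃ D : Set (Fin (s * m * (2 * l + 1)) → ZMod p),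
        IsPDS D v k lam mu ∧ IsCayleySRG D v k lam mu := by
  subst hq
  have hp := (Fact.out : p.Prime).two_le
  have : NeZero l := ⟨by omega⟩
  let E := GaloisField p (s * m)
  let K := FiniteField.Extension E p l
  let L := FiniteField.Extension E p (l + 1)
  let : Fintype E := Fintype.ofFinite E
  let : Fintype K := Fintype.ofFinite K
  let : Fintype L := Fintype.ofFinite L
  have hsm : s * m ≠ 0 := Nat.mul_ne_zero (by omega) (by omega)
  have hE : Fintype.card E = p ^ (s * m) := by
    rw [← Nat.card_eq_fintype_card]
    exact GaloisField.card p _ hsm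
  have hK : Module.finrank E K = l := FiniteField.finrank_extension E p l
  have hL : Module.finrank E L = l + 1 := FiniteField.finrank_extension E p (l + 1)
  -- The norm set construction needs R only as an additive subgroup, so a subgroup of the right
  -- p-power order suffices and no F_q-structure is chosen.
  obtain ⟨R, hR⟩ : ∃ R : AddSubgroup E, Nat.card R = (p ^ s) ^ r := by
    have hdvd : p ^ (s * r) ∣ Nat.card (Multiplicative E) := by
      rw [Nat.card_congr Multiplicative.toAdd, Nat.card_eq_fintype_card, hE]
      exact pow_dvd_pow _ (Nat.mul_le_mul_left s hr)
    obtain ⟨H, hH⟩ := Sylow.exists_subgroup_card_pow_prime p hdvd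
    exact ⟨AddSubgroup.toSubgroup.symm H, by rw [← pow_mul, ← hH]; rfl⟩
  obtain ⟨v, k, lam, mu, hpar, hpds, hsrg⟩ := exists_params_isPDS_normSet (K := K) (L := L)
    (q := p ^ s) (m := m) (hp.trans (Nat.le_self_pow (by omega) p)) (by rw [hE, pow_mul])
    hK hL R hR
  obtain ⟨f⟩ := nonempty_prod_addEquiv_zmod_pi (s := s) (m := m) hE hK hL
  have hmem : ∀ g, f g ∈ f '' normSet K L R ↔ g ∈ normSet K L R :=
    fun g ↦ f.injective.mem_set_image
  refine ⟨v, k, lam, mu, hpar, f '' normSet K L R, hpds.map f, (hpds.map f).isCayleySRG ?_ ?_ ?_⟩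
  · intro g
    obtain ⟨g, rfl⟩ := f.surjective g
    rw [← map_neg, hmem, hmem, neg_mem_normSet]
  · exact ⟨f (1, 0), (hmem _).2 ((mk_zero_mem_normSet R 1).2 one_ne_zero)⟩
  · refine ⟨f (0, 1), ?_, mt (hmem _).1 (zero_mk_notMem_normSet R 1)⟩
    rw [ne_eq, EmbeddingLike.map_eq_zero_iff]
    simp

end Parameters

theorem mainTheorem1 (p s q m l : ℕ) [Fact p.Prime] (hs : 1 ≤ s) (hq : q = p ^ s)
    (hm : 1 ≤ m) (hl : 1 ≤ l) :
    (∀ (F : Type u₁) [Field F] (E : Type u₂) [Field E] [Algebra F E]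
      (K : Type u₃) [Field K] [Fintype K] [Algebra E K]
      (L : Type u₄) [Field L] [Fintype L] [Algebra E L],
      Nat.card F = q → Module.finrank F E = m →
      Module.finrank E K = l → Module.finrank E L = l + 1 →
      -- the additive group is elementary abelian
      Nonempty (K × L ≃+ (Fin (s * m * (2 * l + 1)) → ZMod p)) ∧
      ∀ γ : Eˣ, IsPrimitiveElt γ →
        -- compatible primitive elements exist
        (∃ (α : Kˣ) (β : Lˣ), IsPrimitiveElt α ∧ IsPrimitiveElt β ∧
          Algebra.norm E (α : K) = (γ : E) ∧ Algebra.norm E (β : L) = (γ : E)) ∧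
        ∀ (α : Kˣ) (β : Lˣ), IsPrimitiveElt α → IsPrimitiveElt β →
          Algebra.norm E (α : K) = (γ : E) → Algebra.norm E (β : L) = (γ : E) →
          ∀ (r : ℕ) (R : Submodule F E), Module.finrank F R = r →
          ∀ e : ℕ, e = (q ^ m - 1) / (q - 1) →
          ∀ T : Set ℕ, T = exponentSet R γ e →
          ∀ D : Set (K × L), D = dennistonSet α β e T →
            (∃ v k lam mu : ℕ, IsGenDennistonParams q m l r v k lam mu ∧
              IsPDS D v k lam mu ∧ IsCayleySRG D v k lam mu) ∧
            D = {z : K × L | z.1 ≠ 0 ∧ z.2 ≠ 0 ∧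
                  Algebra.norm E z.2 / Algebra.norm E z.1 ∈ ⋃ t ∈ T, cyclotomicClass γ e t} ∪
                {z : K × L | z.1 ≠ 0 ∧ z.2 = 0} ∧
            D = {z : K × L | z.1 ≠ 0 ∧ z.2 ≠ 0 ∧
                  Algebra.norm E z.2 / Algebra.norm E z.1 ∈ (R : Set E) \ {0}} ∪
                {z : K × L | z.1 ≠ 0 ∧ z.2 = 0} ∧
            (SimpleGraph.addCayley D).IsMaximumClique
              (Finset.univ ×ˢ {0} : Finset (K × L)) ∧
            (Finset.univ ×ˢ {0} : Finset (K × L)).card = q ^ (m * l)) ∧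
    -- the resulting existence theorem in the elementary abelian group
    (∀ r : ℕ, r ≤ m → ∃ v k lam mu : ℕ, IsGenDennistonParams q m l r v k lam mu ∧
      ∃ D : Set (Fin (s * m * (2 * l + 1)) → ZMod p),
        IsPDS D v k lam mu ∧ IsCayleySRG D v k lam mu) := by

  have hp := (Fact.out : p.Prime).two_le
  have hq2 : 2 ≤ q := hq ▸ hp.trans (Nat.le_self_pow (by omega) p)
  refine ⟨?_, fun r hr ↦ exists_pds_zmod_pi hs hq hm hl hr⟩
  intro F _ E _ _ K _ _ _ L _ _ _ hF hE hK hL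
  have : Finite F := Nat.finite_of_card_ne_zero (by omega)
  have : Module.Finite F E := Module.finite_of_finrank_pos (by omega)
  have : Finite E := Module.finite_of_finite F
  have := Fintype.ofFinite E
  have := Fintype.ofFinite F
  have hEc : Nat.card E = q ^ m := by rw [Module.natCard_eq_pow_finrank (K := F), hF, hE]
  have hEc' : Fintype.card E = q ^ m := by rw [← Nat.card_eq_fintype_card, hEc]
  have : CharP E p := charP_of_card_eq_prime_pow (f := s * m) (by rw [hEc', hq, pow_mul])
  refine ⟨nonempty_prod_addEquiv_zmod_pi (by rw [hEc', hq, pow_mul]) hK hL, fun γ hγ ↦ ⟨?_, ?_⟩⟩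
  · obtain ⟨α, hα, hNα⟩ := exists_isPrimitiveElt_norm_eq K hγ
    obtain ⟨β, hβ, hNβ⟩ := exists_isPrimitiveElt_norm_eq L hγ
    exact ⟨α, β, hα, hβ, hNα, hNβ⟩
  · rintro α β hα hβ hNα hNβ r R hR e he T rfl D rfl
    -- The order of γ is q^m - 1, which q - 1 divides, so the natural-number quotient defining e is
    -- exact.
    have he1 : e * (Nat.card F - 1) = orderOf γ := by
      rw [orderOf_eq_of_isPrimitiveElt hγ, hF, hEc, he]
      exact Nat.div_mul_cancel (by simpa using Nat.sub_dvd_pow_sub_pow q 1 m)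
    have he0 : e ≠ 0 := by
      rintro rfl
      rw [zero_mul] at he1
      exact (orderOf_pos γ).ne he1
    have hRc : Nat.card R.toAddSubgroup = q ^ r := by
      rw [← hF, ← hR]
      exact Module.natCard_eq_pow_finrank (K := F) (V := R)
    have hKc : Fintype.card K = q ^ (m * l) := by
      rw [Module.card_eq_pow_finrank (K := E) (V := K), hEc', hK, pow_mul]
    rw [iUnion_cyclotomicClass_eq R hγ he0 he1,
      dennistonSet_eq_normSet R hα hβ hNα hNβ he0 he1]
    refine ⟨exists_params_isPDS_normSet hq2 hEc' hK hL _ hRc, normSet_eq_union _,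
      normSet_eq_union _, isMaximumClique_normSet _, ?_⟩
    rw [Finset.card_product, Finset.card_singleton, mul_one, Finset.card_univ, hKc]
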